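/- Let $K\subset\mathbb{C}$ be an imaginary quadratic field of discriminant $d_K$ with ring of integers $\mathcal{O}_K$, other than $\mathbb{Q}(\sqrt{-1})$ and $\mathbb{Q}(\sqrt{-3})$, let $N$ be a positive integer and $\mathfrak{n}=N\mathcal{O}_K$. Let $\mathcal{Q}_N(d_K)$ be the set of primitive positive definite forms $Q=ax^2+bxy+cy^2\in\mathbb{Z}[x,y]$ of discriminant $b^2-4ac=d_K$ with $\gcd(N,a)=1$. For $\sigma=\begin{bmatrix}r&s\\u&v\end{bmatrix}\in\mathrm{SL}_2(\mathbb{Z})$ put $Q^\sigma(x,y)=Q(rx+sy,\,ux+vy)$ and, for $\omega$ in the upper half-plane $\mathbb{H}$, $j(\sigma,\omega)=u\omega+v$. Let $\pm\Gamma_1(N)$ be the group of all $\sigma\in\mathrm{SL}_2(\mathbb{Z})$ with $\sigma\equiv\pm\begin{bmatrix}1&*\\0&1\end{bmatrix}\pmod N$, and let $\mathrm{C}_N(d_K)$ be the set of classes $[Q]$ of $\mathcal{Q}_N(d_K)$ under $Q\sim_N Q^\sigma$ $(\sigma\in\pm\Gamma_1(N))$. Let $\omega_Q$ be the zero of $Q(x,1)$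 in $\mathbb{H}$, and write $[\omega,1]=\mathbb{Z}\omega+\mathbb{Z}$. Let $\mathrm{Cl}(\mathfrak{n})=I_K(\mathfrak{n})/P_{K,1}(\mathfrak{n})$ be the ray class group, where $I_K(\mathfrak{n})$ is the group of fractional ideals of $K$ prime to $\mathfrak{n}$ and $P_{K,1}(\mathfrak{n})$ is its subgroup of principal ideals $\lambda\mathcal{O}_K$ with $\lambda\equiv^*1\pmod{\mathfrak{n}}$, i.e. $\lambda=\alpha/\beta$ with nonzero $\alpha,\beta\in\mathcal{O}_K$ prime to $\mathfrak{n}$ and $\alpha\equiv\beta\pmod{\mathfrak{n}}$. Then for each $Q\in\mathcal{Q}_N(d_K)$ the lattice $[\omega_Q,1]$ is a fractional ideal of $K$ prime to $\mathfrak{n}$, and $$\phi_N:\mathrm{C}_N(d_K)\to\mathrm{Cl}(\mathfrak{n}),\qquad [Q]\mapsto\text{ray class of }[\omega_Q,1]$$ is a well-defined bijection. Consequently $\mathrm{C}_N(d_K)$ is an abelian group for which $\phi_N$ is an isomorphism of groups. Its operation is given by Dirichlet composition as follows. Let $Q_i=a_ix^2+b_ixy+c_iy^2\in\mathcal{Q}_N(d_K)$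 for $i=1,2$. 1. There is $\rho\in\mathrm{SL}_2(\mathbb{Z})$ such that $Q_3=Q_2^{\rho}=a_3x^2+b_3xy+c_3y^2$ satisfies $\gcd(a_1,a_3,(b_1+b_3)/2)=1$. 2. For each such $\rho$ there is $B\in\mathbb{Z}$ with $B\equiv b_1\pmod{2a_1}$, $B\equiv b_3\pmod{2a_3}$ and $B^2\equiv d_K\pmod{4a_1a_3}$. 3. For each such $\rho$ and $B$, the Dirichlet composition $Q_0=a_1a_3x^2+Bxy+\frac{B^2-d_K}{4a_1a_3}y^2$ satisfies $[\omega_{Q_1},1][\omega_{Q_3},1]=[\omega_{Q_0},1]$, and there are $u,v\in\mathbb{Z}$ with $j(\rho,\omega_{Q_3})=u\,\omega_{Q_0}+v$. 4. For such $u,v$ there is $\sigma\in\mathrm{SL}_2(\mathbb{Z})$ whose second row is congruent to $(u,v)$ modulo $N$; and for each such $\sigma$ there is $Q_4\in\mathcal{Q}_N(d_K)$ with $Q_4^{\sigma}=Q_0$ (so $\omega_{Q_4}=\sigma(\omega_{Q_0})$) and $[Q_1]\cdot[Q_2]=[Q_4]$. -/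

import Mathlib

open NumberField
open scoped MatrixGroups nonZeroDivisors

/-- An integral binary quadratic form `a x² + b x y + c y²`. -/
@[ext]
structure BinForm where
  a : ℤ
  b : ℤ
  c : ℤ

namespace BinForm

/-- The value `Q(x, y)`. -/
def eval (Q : BinForm) (x y : ℤ) : ℤ := Q.a * x ^ 2 + Q.b * x * y + Q.c * y ^ 2

/-- The discriminant `b² - 4ac`. -/
def disc (Q : BinForm) : ℤ := Q.b ^ 2 - 4 * Q.a * Q.c

/-- The coefficients have no common divisor. -/
def IsPrimitive (Q : BinForm) : Prop := Int.gcd Q.a (Int.gcd Q.b Q.c) = 1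

/-- The form takes only positive values away from the origin. -/
def IsPosDef (Q : BinForm) : Prop := ∀ x y : ℤ, (x, y) ≠ (0, 0) → 0 < Q.eval x y

/-- The form `Q^σ(x, y) = Q(σ (x, y)ᵗ)`, that is, `Q (r x + s y, u x + v y)` for the
matrix `σ` with rows `(r, s)` and `(u, v)`. -/
def act (Q : BinForm) (σ : SL(2, ℤ)) : BinForm where
  a := Q.a * σ 0 0 ^ 2 + Q.b * σ 0 0 * σ 1 0 + Q.c * σ 1 0 ^ 2
  b := 2 * Q.a * σ 0 0 * σ 0 1 + Q.b * (σ 0 0 * σ 1 1 + σ 0 1 * σ 1 0) + 2 * Q.c * σ 1 0 * σ 1 1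
  c := Q.a * σ 0 1 ^ 2 + Q.b * σ 0 1 * σ 1 1 + Q.c * σ 1 1 ^ 2

theorem eval_act (Q : BinForm) (σ : SL(2, ℤ)) (x y : ℤ) :
    (Q.act σ).eval x y = Q.eval (σ 0 0 * x + σ 0 1 * y) (σ 1 0 * x + σ 1 1 * y) := by
  simp only [act, eval]
  ring

theorem act_one (Q : BinForm) : Q.act 1 = Q := by
  ext <;> simp [act]

theorem act_mul (Q : BinForm) (σ τ : SL(2, ℤ)) : Q.act (σ * τ) = (Q.act σ).act τ := by
  ext <;> simp [act, Matrix.mul_apply, Fin.sum_univ_two] <;> ring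

/-- For a positive definite form `Q`, the zero `ω_Q = (-b + √D) / (2a)` of `Q(x, 1)` in the
complex upper half-plane (see `omega_spec`). -/
noncomputable def omega (Q : BinForm) : ℂ :=
  (-(Q.b : ℂ) + Complex.I * (Real.sqrt (-(Q.disc : ℝ)) : ℂ)) / (2 * (Q.a : ℂ))

/-- `omega Q` is the one zero of `Q(x, 1)` in the upper half-plane. -/
theorem omega_spec (Q : BinForm) (ha : 0 < Q.a) (hD : Q.disc < 0) (z : ℂ) :
    (0 < z.im ∧ (Q.a : ℂ) * z ^ 2 + Q.b * z + Q.c = 0) ↔ z = Q.omega := by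
  have haR : (0 : ℝ) < Q.a := by exact_mod_cast ha
  have haC : (Q.a : ℂ) ≠ 0 := by exact_mod_cast ha.ne'
  have hDR : (0 : ℝ) < -(Q.disc : ℝ) := by
    have : (Q.disc : ℝ) < 0 := by exact_mod_cast hD
    linarith
  have hs : 0 < Real.sqrt (-(Q.disc : ℝ)) := Real.sqrt_pos.mpr hDR
  have hsq : ((Real.sqrt (-(Q.disc : ℝ)) : ℝ) : ℂ) ^ 2 = -((Q.b : ℂ) ^ 2 - 4 * Q.a * Q.c) := by
    rw [← Complex.ofReal_pow, Real.sq_sqrt hDR.le]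
    simp [disc]
  generalize hS : Real.sqrt (-(Q.disc : ℝ)) = s at hs hsq
  have hom : Q.omega = (-(Q.b : ℂ) + Complex.I * (s : ℂ)) / (2 * (Q.a : ℂ)) := by
    rw [omega, hS]
  have key : 2 * (Q.a : ℂ) * Q.omega = -(Q.b : ℂ) + Complex.I * s := by
    rw [hom]; field_simp
  have him : Q.omega.im = s / (2 * Q.a) := by
    have h1 := congrArg Complex.im key
    simp at h1
    field_simp
    linarith
  constructor
  · rintro ⟨hz, h0⟩
    have h1 : (2 * (Q.a : ℂ) * z + Q.b - Complex.I * s) *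
        (2 * (Q.a : ℂ) * z + Q.b + Complex.I * s) = 0 := by
      have hI := Complex.I_sq
      linear_combination 4 * (Q.a : ℂ) * h0 - (s : ℂ) ^ 2 * hI + hsq
    rcases mul_eq_zero.mp h1 with h | h
    · have : 2 * (Q.a : ℂ) * z = 2 * (Q.a : ℂ) * Q.omega := by
        rw [key]; linear_combination h
      exact mul_left_cancel₀ (mul_ne_zero two_ne_zero haC) this
    · exfalso
      have h2 := congrArg Complex.im h
      simp at h2
      have : 0 < (Q.a : ℝ) * z.im := mul_pos haR hz
      linarith
  · rintro rfl
    refine ⟨by rw [him]; positivity, ?_⟩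
    have hI := Complex.I_sq
    have h4 : 4 * (Q.a : ℂ) * ((Q.a : ℂ) * Q.omega ^ 2 + Q.b * Q.omega + Q.c) = 0 := by
      linear_combination (2 * (Q.a : ℂ) * Q.omega + Q.b + Complex.I * s) * key
        + (s : ℂ) ^ 2 * hI - hsq
    exact (mul_eq_zero.mp h4).resolve_left (mul_ne_zero (by norm_num) haC)

/-- `gcd (a₁, a₂, (b₁ + b₂) / 2) = 1`; for forms of the same discriminant `b₁ + b₂` is even. -/
def Composable (Q₁ Q₂ : BinForm) : Prop :=
  Int.gcd Q₁.a (Int.gcd Q₂.a ((Q₁.b + Q₂.b) / 2)) = 1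

/-- `B ≡ b₁ mod 2a₁`, `B ≡ b₂ mod 2a₂` and `B² ≡ D mod 4a₁a₂`, where `D` is the discriminant
of `Q₁`. -/
def IsCompositionCoeff (Q₁ Q₂ : BinForm) (B : ℤ) : Prop :=
  B ≡ Q₁.b [ZMOD 2 * Q₁.a] ∧ B ≡ Q₂.b [ZMOD 2 * Q₂.a] ∧
    B ^ 2 ≡ Q₁.disc [ZMOD 4 * Q₁.a * Q₂.a]

/-- The Dirichlet composition `a₁a₂ x² + B x y + (B² - D)/(4a₁a₂) y²` of two forms of
discriminant `D`. -/
def dirichletComp (Q₁ Q₂ : BinForm) (B : ℤ) : BinForm where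
  a := Q₁.a * Q₂.a
  b := B
  c := (B ^ 2 - Q₁.disc) / (4 * Q₁.a * Q₂.a)

end BinForm

/-- The congruence subgroup `±Γ₁(N)` of `SL₂(ℤ)`. -/
def pmGamma1 (N : ℕ) : Subgroup SL(2, ℤ) where
  carrier := {σ | σ ∈ CongruenceSubgroup.Gamma1 N ∨ -σ ∈ CongruenceSubgroup.Gamma1 N}
  one_mem' := Or.inl (one_mem _)
  mul_mem' := by
    rintro σ τ (hσ | hσ) (hτ | hτ)
    · exact Or.inl (mul_mem hσ hτ)
    · exact Or.inr (by simpa using mul_mem hσ hτ)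
    · exact Or.inr (by simpa using mul_mem hσ hτ)
    · exact Or.inl (by simpa using mul_mem hσ hτ)
  inv_mem' := by
    rintro σ (hσ | hσ)
    · exact Or.inl (inv_mem hσ)
    · exact Or.inr (by simpa using inv_mem hσ)

/-- `𝒬_N(d)`: primitive positive definite forms of discriminant `d` with `gcd(N, a) = 1`. -/
def FormsPrimeTo (N : ℕ) (d : ℤ) : Type :=
  {Q : BinForm // Q.IsPrimitive ∧ Q.IsPosDef ∧ Q.disc = d ∧ Int.gcd N Q.a = 1}

/-- The equivalence relation `∼_N` on `𝒬_N(d)` given by the action of `±Γ₁(N)`. -/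
def formSetoid (N : ℕ) (d : ℤ) : Setoid (FormsPrimeTo N d) where
  r Q Q' := ∃ σ ∈ pmGamma1 N, Q'.1 = Q.1.act σ
  iseqv :=
    { refl := fun Q => ⟨1, one_mem _, (Q.1.act_one).symm⟩
      symm := by
        rintro Q Q' ⟨σ, hσ, h⟩
        exact ⟨σ⁻¹, inv_mem hσ, by rw [h, ← BinForm.act_mul, mul_inv_cancel, BinForm.act_one]⟩
      trans := by
        rintro Q Q' Q'' ⟨σ, hσ, h⟩ ⟨τ, hτ, h'⟩
        exact ⟨σ * τ, mul_mem hσ hτ, by rw [h', h, BinForm.act_mul]⟩ }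

/-- The set of classes `C_N(d) = 𝒬_N(d) / ∼_N`. -/
def FormClass (N : ℕ) (d : ℤ) : Type := Quotient (formSetoid N d)

/-- The class `[Q]` of a form. -/
def FormClass.mk {N : ℕ} {d : ℤ} (Q : FormsPrimeTo N d) : FormClass N d :=
  Quotient.mk (formSetoid N d) Q

/-- The lattice `[ω, 1] = ℤω + ℤ` in `ℂ`. -/
def lattice (ω : ℂ) : Submodule ℤ ℂ := Submodule.span ℤ {ω, 1}

section RayClass

variable (K : Type*) [Field K] [NumberField K]

/-- `I_K(𝔫)`: the fractional ideals prime to `𝔫`, that is, those in whose factorization no prime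
dividing `𝔫` occurs. -/
noncomputable def idealsPrimeTo (𝔫 : Ideal (𝓞 K)) : Subgroup (FractionalIdeal (𝓞 K)⁰ K)ˣ where
  carrier := {I | ∀ v : IsDedekindDomain.HeightOneSpectrum (𝓞 K), v.asIdeal ∣ 𝔫 →
    FractionalIdeal.count K v (I : FractionalIdeal (𝓞 K)⁰ K) = 0}
  one_mem' := fun v _ => by simp [FractionalIdeal.count_one]
  mul_mem' := by
    intro I J hI hJ v hv
    rw [Units.val_mul, FractionalIdeal.count_mul K v I.ne_zero J.ne_zero, hI v hv, hJ v hv,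
      add_zero]
  inv_mem' := by
    intro I hI v hv
    rw [Units.val_inv_eq_inv_val, FractionalIdeal.count_inv, hI v hv, neg_zero]

/-- The group of `λ ∈ Kˣ` with `λ ≡* 1 mod 𝔫`: quotients `λ = α / β` of nonzero algebraic integers
prime to `𝔫` with `α ≡ β mod 𝔫`. -/
def congrOne (𝔫 : Ideal (𝓞 K)) : Subgroup Kˣ where
  carrier := {l | ∃ α β : 𝓞 K, α ≠ 0 ∧ β ≠ 0 ∧ IsCoprime (Ideal.span {α}) 𝔫 ∧
    IsCoprime (Ideal.span {β}) 𝔫 ∧ α - β ∈ 𝔫 ∧ (l : K) = (α : K) / (β : K)}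
  one_mem' := ⟨1, 1, one_ne_zero, one_ne_zero,
    by simpa using (isCoprime_one_left (x := 𝔫)), by simpa using (isCoprime_one_left (x := 𝔫)),
    by simp, by simp⟩
  mul_mem' := by
    rintro l m ⟨α, β, hα, hβ, cα, cβ, h, hl⟩ ⟨α', β', hα', hβ', cα', cβ', h', hm⟩
    refine ⟨α * α', β * β', mul_ne_zero hα hα', mul_ne_zero hβ hβ', ?_, ?_, ?_, ?_⟩
    · rw [← Ideal.span_singleton_mul_span_singleton]; exact cα.mul_left cα'
    · rw [← Ideal.span_singleton_mul_span_singleton]; exact cβ.mul_left cβ'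
    · have : α * α' - β * β' = α' * (α - β) + β * (α' - β') := by ring
      rw [this]
      exact 𝔫.add_mem (𝔫.mul_mem_left _ h) (𝔫.mul_mem_left _ h')
    · rw [Units.val_mul, hl, hm, div_mul_div_comm]
      push_cast
      rfl
  inv_mem' := by
    rintro l ⟨α, β, hα, hβ, cα, cβ, h, hl⟩
    refine ⟨β, α, hβ, hα, cβ, cα, ?_, ?_⟩
    · rw [← neg_sub]; exact 𝔫.neg_mem h
    · rw [Units.val_inv_eq_inv_val, hl, inv_div]

/-- `P_{K,1}(𝔫)`: the principal fractional ideals `λ𝓞_K` with `λ ≡* 1 mod 𝔫`. -/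
noncomputable def rayPrincipal (𝔫 : Ideal (𝓞 K)) : Subgroup (FractionalIdeal (𝓞 K)⁰ K)ˣ :=
  (congrOne K 𝔫).map (toPrincipalIdeal (𝓞 K) K)

/-- The ray class group `Cl(𝔫) = I_K(𝔫) / P_{K,1}(𝔫)`. -/
abbrev RayClassGroup (𝔫 : Ideal (𝓞 K)) : Type _ :=
  idealsPrimeTo K 𝔫 ⧸ (rayPrincipal K 𝔫).subgroupOf (idealsPrimeTo K 𝔫)

end RayClass

/-!
Scaling a ℤ-basis of a fractional ideal so that its second vector is `1` turns it into `(ω_Q, 1)`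
for exactly one primitive positive definite form `Q` of discriminant `d_K`, and changing the basis
by `SL₂(ℤ)` acts on `Q`. Two forms give the same ray class when their lattices `[ω_Q, 1]` and
`[ω_R, 1]` differ by a factor `λ ≡* 1 (mod N)`; writing `λ = u ω + v` in the basis `(ω, 1)`, this
condition reads `u ≡ 0` and `v ≡ 1 (mod N)`, and `(u, v)` is the second row of the matrix relating
the forms. The sign in `±Γ₁(N)` comes from `-1`, which acts trivially on forms.
-/

section Arithmetic

theorem exists_int_prime_dvd_iff {M : ℤ} (hM : M ≠ 0) (P : ℕ → Prop) :
    ∃ t : ℤ, ∀ p : ℕ, p.Prime → ((p : ℤ) ∣ t ↔ (p : ℤ) ∣ M ∧ P p) := by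
  classical
  refine ⟨((∏ q ∈ M.natAbs.primeFactors with P q, q : ℕ) : ℤ), fun p hp => ?_⟩
  rw [Int.natCast_dvd_natCast, hp.prime.dvd_finsetProd_iff]
  constructor
  · rintro ⟨q, hq, hpq⟩
    rw [Finset.mem_filter, Nat.mem_primeFactors] at hq
    obtain rfl := (Nat.prime_dvd_prime_iff_eq hp hq.1.1).mp hpq
    exact ⟨Int.natCast_dvd.mpr hq.1.2.1, hq.2⟩
  · rintro ⟨hpM, hP⟩
    exact ⟨p, by simp [hp, hM, hP, Int.natCast_dvd.mp hpM], dvd_rfl⟩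

theorem isCoprime_of_forall_prime_not_dvd {a b : ℤ}
    (h : ∀ p : ℕ, p.Prime → (p : ℤ) ∣ a → ¬(p : ℤ) ∣ b) : IsCoprime a b :=
  Int.isCoprime_iff_gcd_eq_one.mpr <| Nat.coprime_of_dvd fun p hp ha hb =>
    h p hp (Int.natCast_dvd.mpr ha) (Int.natCast_dvd.mpr hb)

theorem exists_isCoprime_add_mul {a b M : ℤ} (hM : M ≠ 0) (h : IsCoprime (Int.gcd a b : ℤ) M) :
    ∃ t : ℤ, IsCoprime (a + b * t) M := by
  obtain ⟨t, ht⟩ := exists_int_prime_dvd_iff hM (fun p => ¬(p : ℤ) ∣ a)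
  refine ⟨t, isCoprime_of_forall_prime_not_dvd fun p hp hpt hpM => ?_⟩
  have hp' := Nat.prime_iff_prime_int.mp hp
  by_cases hpa : (p : ℤ) ∣ a
  · rcases hp'.dvd_or_dvd ((dvd_add_right hpa).mp hpt) with hpb | hpt
    · exact hp'.not_isUnit (h.isUnit_of_dvd' (Int.dvd_coe_gcd hpa hpb) hpM)
    · exact ((ht p hp).mp hpt).2 hpa
  · exact hpa ((dvd_add_left (((ht p hp).mpr ⟨hpM, hpa⟩).mul_left b)).mp hpt)

theorem exists_SL2_row_modEq {u v N : ℤ} (hN : N ≠ 0) (h : IsCoprime (Int.gcd u v : ℤ) N) :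
    ∃ σ : SL(2, ℤ), σ 1 0 ≡ u [ZMOD N] ∧ σ 1 1 ≡ v [ZMOD N] := by
  obtain ⟨w, hw, hwv⟩ : ∃ w : ℤ, w ≠ 0 ∧ w ≡ v [ZMOD N] := by
    by_cases hv : v = 0
    · exact ⟨N, hN, by simp [hv, Int.ModEq]⟩
    · exact ⟨v, hv, rfl⟩
  obtain ⟨t, ht⟩ := exists_isCoprime_add_mul (a := u) (b := N) hw <|
    isCoprime_of_forall_prime_not_dvd fun p hp hpuN hpw => by
      have hpN := hpuN.trans (Int.gcd_dvd_right ..)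
      have hpv := (hwv.of_dvd hpN).dvd_iff.mp hpw
      exact (Nat.prime_iff_prime_int.mp hp).not_isUnit
        (h.isUnit_of_dvd' (Int.dvd_coe_gcd (hpuN.trans (Int.gcd_dvd_left ..)) hpv) hpN)
  obtain ⟨σ, h0, h1⟩ := ht.exists_SL2_row 1
  exact ⟨σ, by simp [h0, Int.ModEq], by rwa [h1]⟩

theorem SL2_det_cast {R : Type*} [CommRing R] (σ : SL(2, ℤ)) :
    (σ 0 0 : R) * σ 1 1 - σ 0 1 * σ 1 0 = 1 := by
  have h : σ 0 0 * σ 1 1 - σ 0 1 * σ 1 0 = 1 := by rw [← Matrix.det_fin_two, σ.det_coe]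
  exact_mod_cast congrArg (Int.cast : ℤ → R) h

end Arithmetic

namespace BinForm

theorem IsPrimitive.not_prime_dvd {Q : BinForm} (hQ : Q.IsPrimitive) {p : ℕ} (hp : p.Prime)
    (ha : (p : ℤ) ∣ Q.a) (hb : (p : ℤ) ∣ Q.b) : ¬(p : ℤ) ∣ Q.c := by
  intro hc
  have h : (p : ℤ) ∣ (Int.gcd Q.a (Int.gcd Q.b Q.c) : ℤ) :=
    Int.dvd_coe_gcd ha (Int.dvd_coe_gcd hb hc)
  rw [hQ] at h
  exact (Nat.prime_iff_prime_int.mp hp).not_dvd_one h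

theorem IsPrimitive.exists_isCoprime_eval {Q : BinForm} (hQ : Q.IsPrimitive) {M : ℤ}
    (hM : M ≠ 0) : ∃ x y : ℤ, IsCoprime x y ∧ IsCoprime M (Q.eval x y) := by
  -- modulo `p ∣ M`: `y = 0 ≠ x` if `p ∤ a`, else `x = 0 ≠ y` if `p ∤ c`, else both are nonzero
  obtain ⟨y, hy⟩ := exists_int_prime_dvd_iff hM (fun p => ¬(p : ℤ) ∣ Q.a)
  obtain ⟨x, hx⟩ := exists_int_prime_dvd_iff hM (fun p => (p : ℤ) ∣ Q.a ∧ ¬(p : ℤ) ∣ Q.c)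
  refine ⟨x, y, isCoprime_of_forall_prime_not_dvd fun p hp hpx hpy =>
      ((hy p hp).mp hpy).2 ((hx p hp).mp hpx).2.1,
    isCoprime_of_forall_prime_not_dvd fun p hp hpM => ?_⟩
  have := Fact.mk hp
  have hQp := hQ.not_prime_dvd hp
  specialize hx p hp
  specialize hy p hp
  simp only [eval, hpM, true_and, ← ZMod.intCast_zmod_eq_zero_iff_dvd] at hx hy hQp ⊢
  push_cast at hx hy hQp ⊢
  by_cases ha : (Q.a : ZMod p) = 0 <;> by_cases hc : (Q.c : ZMod p) = 0 <;> simp_all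

theorem disc_act (Q : BinForm) (σ : SL(2, ℤ)) : (Q.act σ).disc = Q.disc := by
  simp only [disc, act]
  linear_combination (Q.b ^ 2 - 4 * Q.a * Q.c) *
    (σ 0 0 * σ 1 1 - σ 0 1 * σ 1 0 + 1) * SL2_det_cast (R := ℤ) σ

theorem act_neg (Q : BinForm) (σ : SL(2, ℤ)) : Q.act (-σ) = Q.act σ := by
  ext <;> simp [act]

theorem act_eval_cast {R : Type*} [CommRing R] (Q : BinForm) (σ : SL(2, ℤ)) (x y : R) :
    (Q.act σ).a * x ^ 2 + (Q.act σ).b * (x * y) + (Q.act σ).c * y ^ 2 =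
      Q.a * (σ 0 0 * x + σ 0 1 * y) ^ 2 +
        Q.b * ((σ 0 0 * x + σ 0 1 * y) * (σ 1 0 * x + σ 1 1 * y)) +
        Q.c * (σ 1 0 * x + σ 1 1 * y) ^ 2 := by
  simp only [act]
  push_cast
  ring

theorem act_a (Q : BinForm) (σ : SL(2, ℤ)) : (Q.act σ).a = Q.eval (σ 0 0) (σ 1 0) := rfl

theorem act_inv_a (Q : BinForm) (σ : SL(2, ℤ)) : (Q.act σ⁻¹).a = Q.eval (σ 1 1) (-σ 1 0) := by
  rw [act_a]
  simp [Matrix.SpecialLinearGroup.SL2_inv_expl]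

theorem IsPosDef.a_pos {Q : BinForm} (hQ : Q.IsPosDef) : 0 < Q.a := by
  simpa [eval] using hQ 1 0 (by simp)

theorem isPosDef_of_a_pos_of_disc_neg {Q : BinForm} (ha : 0 < Q.a) (hd : Q.disc < 0) :
    Q.IsPosDef := by
  intro x y hxy
  have key : 4 * Q.a * Q.eval x y = (2 * Q.a * x + Q.b * y) ^ 2 + -Q.disc * y ^ 2 := by
    simp only [eval, disc]; ring
  have hd' : 0 < -Q.disc := by linarith
  refine pos_of_mul_pos_right (a := 4 * Q.a) (key ▸ ?_) (by positivity)
  rcases eq_or_ne y 0 with rfl | hy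
  · have hx : x ≠ 0 := by rintro rfl; exact hxy rfl
    have : 2 * Q.a * x ≠ 0 := by simp [hx, ha.ne']
    simpa using sq_pos_of_ne_zero this
  · positivity

theorem IsPosDef.act {Q : BinForm} (hQ : Q.IsPosDef) (σ : SL(2, ℤ)) : (Q.act σ).IsPosDef := by
  intro x y hxy
  rw [eval_act]
  refine hQ _ _ fun h => hxy ?_
  simp only [Prod.mk.injEq] at h ⊢
  have hdet := SL2_det_cast (R := ℤ) σ
  constructor
  · linear_combination σ 1 1 * h.1 - σ 0 1 * h.2 - x * hdet
  · linear_combination σ 0 0 * h.2 - σ 1 0 * h.1 - y * hdet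

theorem exists_composable (Q₁ : BinForm) {Q₂ : BinForm} (h₁ : Q₁.a ≠ 0) (h₂ : Q₂.IsPrimitive) :
    ∃ ρ : SL(2, ℤ), Q₁.Composable (Q₂.act ρ) := by
  obtain ⟨x, y, hxy, h⟩ := h₂.exists_isCoprime_eval h₁
  obtain ⟨ρ, rfl, rfl⟩ := hxy.exists_SL2_col 0
  rw [← act_a] at h
  exact ⟨ρ, Int.isCoprime_iff_gcd_eq_one.mp (h.of_isCoprime_of_dvd_right (Int.gcd_dvd_left ..))⟩

theorem Composable.exists_bezout {Q₁ Q₂ : BinForm} (h : Q₁.Composable Q₂) :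
    ∃ x y z : ℤ, x * Q₁.a + y * Q₂.a + z * ((Q₁.b + Q₂.b) / 2) = 1 := by
  obtain ⟨x, w, hxw⟩ := Int.isCoprime_iff_gcd_eq_one.mpr h
  rw [Int.gcd_eq_gcd_ab] at hxw
  exact ⟨x, w * Int.gcdA Q₂.a ((Q₁.b + Q₂.b) / 2), w * Int.gcdB Q₂.a ((Q₁.b + Q₂.b) / 2),
    by linear_combination hxw⟩

theorem two_dvd_b_add_b {Q₁ Q₂ : BinForm} (h : Q₁.disc = Q₂.disc) : 2 ∣ Q₁.b + Q₂.b := by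
  have hsq : Even (Q₁.b ^ 2 + Q₂.b ^ 2) := by
    unfold disc at h
    exact ⟨Q₂.b ^ 2 + 2 * Q₁.a * Q₁.c - 2 * Q₂.a * Q₂.c, by linear_combination h⟩
  simpa [Int.even_add, Int.even_pow, ← even_iff_two_dvd] using hsq

theorem Composable.exists_isCompositionCoeff {Q₁ Q₂ : BinForm} (h : Q₁.Composable Q₂)
    (hd : Q₁.disc = Q₂.disc) : ∃ B : ℤ, Q₁.IsCompositionCoeff Q₂ B := by
  obtain ⟨x, y, z, hb⟩ := h.exists_bezout
  obtain ⟨s, hs⟩ := two_dvd_b_add_b hd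
  rw [hs, Int.mul_ediv_cancel_left _ two_ne_zero] at hb
  unfold disc at hd
  -- both sides are the integer `(b₁ b₂ + D) / 2`
  have ht : s * Q₁.b - 2 * Q₁.a * Q₁.c = s * Q₂.b - 2 * Q₂.a * Q₂.c :=
    mul_left_cancel₀ two_ne_zero (by linear_combination hd - (Q₁.b - Q₂.b) * hs)
  obtain ⟨B, hB⟩ : ∃ B, B = x * Q₁.a * Q₂.b + y * Q₂.a * Q₁.b + z * (s * Q₁.b - 2 * Q₁.a * Q₁.c) :=
    ⟨_, rfl⟩
  have h₁ : B - Q₁.b = 2 * Q₁.a * (x * (s - Q₁.b) - z * Q₁.c) := by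
    linear_combination hB + Q₁.b * hb + x * Q₁.a * hs
  have h₂ : B - Q₂.b = 2 * Q₂.a * (y * (s - Q₂.b) - z * Q₂.c) := by
    linear_combination hB + Q₂.b * hb + y * Q₂.a * hs + z * ht
  have hsB : s * B - (s * Q₁.b - 2 * Q₁.a * Q₁.c) =
      2 * Q₁.a * Q₂.a * (x * Q₂.c + y * Q₁.c) := by
    linear_combination s * hB + (s * Q₁.b - 2 * Q₁.a * Q₁.c) * hb - x * Q₁.a * ht
  refine ⟨B, (Int.modEq_iff_dvd.mpr ⟨_, h₁⟩).symm, (Int.modEq_iff_dvd.mpr ⟨_, h₂⟩).symm,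
    (Int.modEq_iff_dvd.mpr ⟨(x * (s - Q₁.b) - z * Q₁.c) * (y * (s - Q₂.b) - z * Q₂.c) +
      x * Q₂.c + y * Q₁.c, ?_⟩).symm⟩
  unfold disc
  linear_combination (B - Q₂.b) * h₁ + 2 * Q₁.a * (x * (s - Q₁.b) - z * Q₁.c) * h₂ + 2 * hsB +
    (B - Q₁.b) * hs

section DirichletComposition

variable {Q₁ Q₂ : BinForm} {B : ℤ}

theorem IsCompositionCoeff.four_mul_dirichletComp_c (hB : Q₁.IsCompositionCoeff Q₂ B) :
    4 * (Q₁.a * Q₂.a) * (Q₁.dirichletComp Q₂ B).c = B ^ 2 - Q₁.disc := by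
  rw [← mul_assoc]
  exact Int.mul_ediv_cancel' (Int.modEq_iff_dvd.mp hB.2.2.symm)

theorem IsCompositionCoeff.disc_dirichletComp (hB : Q₁.IsCompositionCoeff Q₂ B) :
    (Q₁.dirichletComp Q₂ B).disc = Q₁.disc := by
  have h := hB.four_mul_dirichletComp_c
  simp only [disc, dirichletComp] at h ⊢
  linear_combination -h

end DirichletComposition

end BinForm

section OrientedBasis

variable {K : Type*} [Field K] {ι : K →+* ℂ}

/-- `(ξ, ν)` is a `ℤ`-basis of the fractional ideal `J`, ordered so that `ξ / ν` lies in the upper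
half-plane of `ℂ ⊇ ι(K)`; the orientation is recorded as `0 < Im (ξ ν̄)`, which also gives the
linear independence. -/
structure IsOrientedBasis (ι : K →+* ℂ) (J : FractionalIdeal (𝓞 K)⁰ K) (ξ ν : K) : Prop where
  mem_iff : ∀ x : K, x ∈ J ↔ ∃ s t : ℤ, x = s * ξ + t * ν
  im_pos : 0 < (ι ξ * starRingEnd ℂ (ι ν)).im

theorem im_map_mul_conj_eq_det_mul (ξ ν : K) (r s u v : ℤ) :
    (ι (r * ξ + s * ν) * starRingEnd ℂ (ι (u * ξ + v * ν))).im =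
      (r * v - s * u : ℤ) * (ι ξ * starRingEnd ℂ (ι ν)).im := by
  simp only [map_add, map_mul, map_intCast, Complex.mul_im, Complex.mul_re, Complex.add_re,
    Complex.add_im, Complex.conj_re, Complex.conj_im, Complex.intCast_re, Complex.intCast_im]
  push_cast
  ring

theorem im_map_combination_mul_conj (ξ ν : K) (s t : ℤ) :
    (ι (s * ξ + t * ν) * starRingEnd ℂ (ι ν)).im = s * (ι ξ * starRingEnd ℂ (ι ν)).im := by
  simpa only [Int.cast_zero, zero_mul, Int.cast_one, one_mul, zero_add, mul_one, mul_zero,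
    sub_zero] using im_map_mul_conj_eq_det_mul (ι := ι) ξ ν s t 0 1

theorem im_map_mul_mul_conj (α ν : K) :
    (ι (α * ν) * starRingEnd ℂ (ι ν)).im = Complex.normSq (ι ν) * (ι α).im := by
  rw [map_mul, mul_assoc, Complex.mul_conj, mul_comm, Complex.im_ofReal_mul]

theorem exists_im_ne_zero [NumberField K] [IsTotallyComplex K] (ι : K →+* ℂ) :
    ∃ α : 𝓞 K, (ι α).im ≠ 0 := by
  by_contra! hreal
  have hconj : ComplexEmbedding.IsReal ι := by
    ext x
    obtain ⟨α, β, -, rfl⟩ := IsFractionRing.div_surjective (A := 𝓞 K) x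
    simp only [map_div₀, ComplexEmbedding.conjugate_coe_eq, Complex.conj_eq_iff_im.mpr (hreal _)]
  exact InfinitePlace.not_isReal_iff_isComplex.mpr
    (IsTotallyComplex.isComplex (InfinitePlace.mk ι)) (InfinitePlace.isReal_mk_iff.mpr hconj)

namespace IsOrientedBasis

variable {J J' : FractionalIdeal (𝓞 K)⁰ K} {ξ ν ξ' ν' : K}

theorem ne_zero (h : IsOrientedBasis ι J ξ ν) : ν ≠ 0 := by
  rintro rfl
  simpa using h.im_pos

theorem left_mem (h : IsOrientedBasis ι J ξ ν) : ξ ∈ J := (h.mem_iff ξ).mpr ⟨1, 0, by simp⟩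

theorem right_mem (h : IsOrientedBasis ι J ξ ν) : ν ∈ J := (h.mem_iff ν).mpr ⟨0, 1, by simp⟩

theorem eq_of_mem (h : IsOrientedBasis ι J ξ ν) (h' : IsOrientedBasis ι J' ξ ν) : J = J' := by
  ext x
  rw [h.mem_iff, h'.mem_iff]

theorem coord_inj (h : IsOrientedBasis ι J ξ ν) {s t s' t' : ℤ}
    (heq : (s * ξ + t * ν : K) = s' * ξ + t' * ν) : s = s' ∧ t = t' := by
  have hs : s = s' := by
    have him := im_map_combination_mul_conj (ι := ι) ξ ν s t
    rw [heq, im_map_combination_mul_conj] at him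
    exact_mod_cast (mul_right_cancel₀ h.im_pos.ne' him).symm
  subst hs
  have := ι.charZero
  simpa [h.ne_zero] using heq

theorem act (h : IsOrientedBasis ι J ξ ν) (σ : SL(2, ℤ)) :
    IsOrientedBasis ι J (σ 0 0 * ξ + σ 0 1 * ν) (σ 1 0 * ξ + σ 1 1 * ν) where
  mem_iff x := by
    have hdet := SL2_det_cast (R := K) σ
    rw [h.mem_iff]
    constructor
    · rintro ⟨s, t, rfl⟩
      refine ⟨s * σ 1 1 - t * σ 1 0, t * σ 0 0 - s * σ 0 1, ?_⟩
      push_cast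
      linear_combination -(s * ξ + t * ν) * hdet
    · rintro ⟨s, t, rfl⟩
      exact ⟨s * σ 0 0 + t * σ 1 0, s * σ 0 1 + t * σ 1 1, by push_cast; ring⟩
  im_pos := by
    rw [im_map_mul_conj_eq_det_mul]
    have hdet := SL2_det_cast (R := ℤ) σ
    simp only [Int.cast_id] at hdet
    simpa [hdet] using h.im_pos

theorem exists_SL2 (h : IsOrientedBasis ι J ξ ν) (h' : IsOrientedBasis ι J ξ' ν') :
    ∃ σ : SL(2, ℤ), ξ' = σ 0 0 * ξ + σ 0 1 * ν ∧ ν' = σ 1 0 * ξ + σ 1 1 * ν := by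
  obtain ⟨r, s, hξ'⟩ := (h.mem_iff ξ').mp h'.left_mem
  obtain ⟨u, v, hν'⟩ := (h.mem_iff ν').mp h'.right_mem
  obtain ⟨r', s', hξ⟩ := (h'.mem_iff ξ).mp h.left_mem
  obtain ⟨u', v', hν⟩ := (h'.mem_iff ν).mp h.right_mem
  have hdet : (ι ξ' * starRingEnd ℂ (ι ν')).im =
      (r * v - s * u : ℤ) * (ι ξ * starRingEnd ℂ (ι ν)).im := by
    rw [hξ', hν', im_map_mul_conj_eq_det_mul]
  have hdet' : (ι ξ * starRingEnd ℂ (ι ν)).im =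
      (r' * v' - s' * u' : ℤ) * (ι ξ' * starRingEnd ℂ (ι ν')).im := by
    conv_lhs => rw [hξ, hν, im_map_mul_conj_eq_det_mul]
  have hpos : 0 < r * v - s * u := by
    have := hdet ▸ h'.im_pos
    exact_mod_cast pos_of_mul_pos_left this h.im_pos.le
  have hmul : (r * v - s * u) * (r' * v' - s' * u') = 1 := by
    have : ((r * v - s * u : ℤ) * (r' * v' - s' * u' : ℤ) : ℝ) = 1 := by
      refine mul_right_cancel₀ h'.im_pos.ne' ?_
      rw [mul_assoc, ← hdet', ← hdet, one_mul]
    exact_mod_cast this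
  have hone : !![r, s; u, v].det = 1 := by
    rw [Matrix.det_fin_two_of]
    exact Int.eq_one_of_mul_eq_one_right hpos.le hmul
  exact ⟨⟨_, hone⟩, by simpa using hξ', by simpa using hν'⟩

theorem smul [NumberField K] (h : IsOrientedBasis ι J ξ ν) {l : K} (hl : l ≠ 0) :
    IsOrientedBasis ι (FractionalIdeal.spanSingleton (𝓞 K)⁰ l * J) (l * ξ) (l * ν) where
  mem_iff x := by
    simp only [FractionalIdeal.mem_singleton_mul, h.mem_iff]
    constructor
    · rintro ⟨_, ⟨s, t, rfl⟩, rfl⟩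
      exact ⟨s, t, by ring⟩
    · rintro ⟨s, t, rfl⟩
      exact ⟨_, ⟨s, t, rfl⟩, by ring⟩
  im_pos := by
    have hl' : 0 < Complex.normSq (ι l) := Complex.normSq_pos.mpr (by simpa using hl)
    have heq : ι (l * ξ) * starRingEnd ℂ (ι (l * ν)) =
        (Complex.normSq (ι l) : ℂ) * (ι ξ * starRingEnd ℂ (ι ν)) := by
      rw [← Complex.mul_conj, map_mul, map_mul, map_mul]
      ring
    rw [heq, Complex.im_ofReal_mul]
    exact mul_pos hl' h.im_pos

end IsOrientedBasis

theorem exists_isOrientedBasis [NumberField K] [Algebra.IsQuadraticExtension ℚ K]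
    [IsTotallyComplex K] (ι : K →+* ℂ) {J : FractionalIdeal (𝓞 K)⁰ K} (hJ : J ≠ 0) :
    ∃ ξ ν : K, IsOrientedBasis ι J ξ ν := by
  have hrank : Module.finrank ℤ J = 2 := by
    rw [← Algebra.IsQuadraticExtension.finrank_eq_two ℚ K, ← RingOfIntegers.rank K]
    exact fractionalIdeal_rank K (Units.mk0 J hJ)
  let b := Module.finBasisOfFinrankEq ℤ (J : Submodule (𝓞 K) K) hrank
  have hmem : ∀ x : K, x ∈ J ↔ ∃ s t : ℤ, x = s * b 0 + t * b 1 := fun x => by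
    constructor
    · intro hx
      have hsum := congrArg Subtype.val (b.sum_repr ⟨x, hx⟩)
      rw [Fin.sum_univ_two] at hsum
      exact ⟨b.repr ⟨x, hx⟩ 0, b.repr ⟨x, hx⟩ 1, by simpa using hsum.symm⟩
    · rintro ⟨s, t, rfl⟩
      simpa using (s • b 0 + t • b 1).2
  have hne : (ι (b 0) * starRingEnd ℂ (ι (b 1))).im ≠ 0 := by
    intro him
    obtain ⟨α, hα⟩ := exists_im_ne_zero ι
    obtain ⟨s, t, hst⟩ := (hmem (α * b 1)).mp ((J : Submodule (𝓞 K) K).smul_mem α (b 1).2)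
    have hb : (b 1 : K) ≠ 0 := by simpa using b.ne_zero 1
    have hzero := im_map_combination_mul_conj (ι := ι) (b 0) (b 1) s t
    rw [← hst, im_map_mul_mul_conj, him, mul_zero] at hzero
    simp_all
  rcases lt_or_gt_of_ne hne with hneg | hpos
  · refine ⟨-b 0, b 1, fun x => ?_, by simpa using hneg⟩
    rw [hmem]
    constructor <;> rintro ⟨s, t, rfl⟩ <;> exact ⟨-s, t, by push_cast; ring⟩
  · exact ⟨b 0, b 1, hmem, hpos⟩

end OrientedBasis

/-- A generator `θ` of the ring of integers of an imaginary quadratic field `K ⊆ ℂ`, with `θ` in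
the upper half-plane, together with the coefficients of its minimal polynomial
`X² - T X + n`. -/
structure OrientedGenerator (K : Type*) [Field K] [NumberField K] (ι : K →+* ℂ) where
  θ : 𝓞 K
  T : ℤ
  n : ℤ
  θ_sq : (θ : K) ^ 2 = T * θ - n
  isOrientedBasis : IsOrientedBasis ι 1 (θ : K) 1

section ImaginaryQuadratic

variable {K : Type*} [Field K] [NumberField K]

theorem isCoprime_of_isCoprime_cast {a b : ℤ} (h : IsCoprime (a : 𝓞 K) (b : 𝓞 K)) :
    IsCoprime a b := by
  rw [Int.isCoprime_iff_gcd_eq_one, ← Int.natAbs_natCast (Int.gcd a b), ← Int.isUnit_iff_natAbs_eq]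
  have hloc : IsLocalHom (algebraMap ℤ (𝓞 K)) := Algebra.IsIntegral.isLocalHom ..
  refine isUnit_of_map_unit (algebraMap ℤ (𝓞 K)) _ (h.isUnit_of_dvd' ?_ ?_)
  · exact map_dvd (algebraMap ℤ (𝓞 K)) (Int.gcd_dvd_left ..)
  · exact map_dvd (algebraMap ℤ (𝓞 K)) (Int.gcd_dvd_right ..)

theorem nonempty_orientedGenerator [Algebra.IsQuadraticExtension ℚ K] [IsTotallyComplex K]
    (ι : K →+* ℂ) : Nonempty (OrientedGenerator K ι) := by
  obtain ⟨e₁, e₂, he⟩ := exists_isOrientedBasis ι (one_ne_zero (α := FractionalIdeal (𝓞 K)⁰ K))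
  obtain ⟨u, v, huv⟩ := (he.mem_iff 1).mp (FractionalIdeal.one_mem_one _)
  obtain ⟨α, hα⟩ := (FractionalIdeal.mem_one_iff _).mp he.left_mem
  obtain ⟨β, hβ⟩ := (FractionalIdeal.mem_one_iff _).mp he.right_mem
  have hcop : IsCoprime u v := isCoprime_of_isCoprime_cast (K := K) ⟨α, β, by
    apply RingOfIntegers.coe_injective
    rw [map_one, huv, ← hα, ← hβ]
    simp only [map_add, map_mul, map_intCast]
    ring⟩
  obtain ⟨σ, rfl, rfl⟩ := hcop.exists_SL2_row 1
  have hθ := huv ▸ he.act σ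
  obtain ⟨θ, hθ'⟩ := (FractionalIdeal.mem_one_iff _).mp hθ.left_mem
  rw [← hθ'] at hθ
  obtain ⟨T, m, hsq⟩ := (hθ.mem_iff _).mp (FractionalIdeal.coe_mem_one _ (θ ^ 2))
  exact ⟨⟨θ, T, -m, by simpa using hsq, hθ⟩⟩

namespace OrientedGenerator

variable {ι : K →+* ℂ} (G : OrientedGenerator K ι)

theorem exists_eq_add_mul_θ (x : 𝓞 K) : ∃ s t : ℤ, x = s + t * G.θ := by
  obtain ⟨t, s, h⟩ := (G.isOrientedBasis.mem_iff x).mp (FractionalIdeal.coe_mem_one _ x)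
  refine ⟨s, t, RingOfIntegers.coe_injective ?_⟩
  simp only [map_add, map_mul, map_intCast]
  linear_combination h

/-- The integral basis `(1, θ)` of `𝓞 K`, used to compute the discriminant. -/
noncomputable def basis : Module.Basis (Fin 2) ℤ (𝓞 K) :=
  Module.Basis.mk (v := ![1, G.θ])
    (LinearIndependent.pair_iff.mpr fun s t h => by
      have h' := congrArg (algebraMap (𝓞 K) K) h
      simp only [map_add, map_mul, map_intCast, map_one, map_zero, zsmul_eq_mul] at h'
      exact (G.isOrientedBasis.coord_inj (s := t) (t := s) (s' := 0) (t' := 0) (by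
        push_cast
        linear_combination h')).symm)
    (fun x _ => by
      obtain ⟨s, t, rfl⟩ := G.exists_eq_add_mul_θ x
      rw [Matrix.range_cons_cons_empty]
      exact Submodule.mem_span_pair.mpr ⟨s, t, by simp⟩)

theorem basis_zero : G.basis 0 = 1 := by simp [basis]

theorem basis_one : G.basis 1 = G.θ := by simp [basis]

theorem leftMulMatrix_θ : Algebra.leftMulMatrix G.basis G.θ = !![0, -G.n; 1, G.T] := by
  have hsq : G.θ * G.θ = -(G.n • G.basis 0) + G.T • G.basis 1 := by
    apply RingOfIntegers.coe_injective
    simp only [map_mul, map_add, map_neg, map_intCast, basis_zero, basis_one, map_one,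
      zsmul_eq_mul]
    linear_combination G.θ_sq
  have hone : G.θ * 1 = G.basis 1 := by rw [mul_one, basis_one]
  ext i j
  rw [Algebra.leftMulMatrix_eq_repr_mul]
  fin_cases j
  · fin_cases i <;> simp [basis_zero, hone]
  · rw [Fin.mk_one, basis_one, hsq]
    fin_cases i <;> simp [-zsmul_eq_mul]

theorem discr_eq : discr K = G.T ^ 2 - 4 * G.n := by
  have hone : Algebra.trace ℤ (𝓞 K) 1 = 2 := by
    simp [Algebra.trace_eq_matrix_trace G.basis]
  have hθ : Algebra.trace ℤ (𝓞 K) G.θ = G.T := by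
    simp [Algebra.trace_eq_matrix_trace G.basis, leftMulMatrix_θ, Matrix.trace_fin_two]
  have hθ_sq : Algebra.trace ℤ (𝓞 K) (G.θ * G.θ) = -G.n + (-G.n + G.T * G.T) := by
    simp [Algebra.trace_eq_matrix_trace G.basis, leftMulMatrix_θ, Matrix.trace_fin_two]
  rw [← discr_eq_discr K G.basis, Algebra.discr_def, Matrix.det_fin_two]
  simp only [Algebra.traceMatrix_apply, Algebra.traceForm_apply, basis_zero, basis_one, one_mul,
    mul_one, hone, hθ, hθ_sq]
  ring

theorem im_θ_pos : 0 < (ι G.θ).im := by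
  simpa using G.isOrientedBasis.im_pos

/-- The square root of the discriminant of `K` in the upper half-plane. -/
def δ : K := 2 * G.θ - G.T

theorem im_δ_pos : 0 < (ι G.δ).im := by
  simpa [δ, map_ofNat ι] using G.im_θ_pos

theorem δ_sq : G.δ ^ 2 = discr K := by
  rw [δ, G.discr_eq]
  push_cast
  linear_combination 4 * G.θ_sq

theorem discr_neg (G : OrientedGenerator K ι) : discr K < 0 := by
  have hsq : ι G.δ ^ 2 = (discr K : ℂ) := by rw [← map_pow, δ_sq, map_intCast]
  have him := congrArg Complex.im hsq
  have hre := congrArg Complex.re hsq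
  simp only [sq, Complex.mul_im, Complex.mul_re, Complex.intCast_im, Complex.intCast_re]
    at him hre
  have hpos := G.im_δ_pos
  have hre_zero : (ι G.δ).re = 0 := mul_right_cancel₀ hpos.ne' (by linarith)
  rw [hre_zero] at hre
  have : (discr K : ℝ) < 0 := by nlinarith
  exact_mod_cast this

end OrientedGenerator

end ImaginaryQuadratic

theorem isIntegral_mul_of_quadratic_eq_zero {R : Type*} [CommRing R] {a b c : ℤ} {w : R}
    (h : (a : R) * w ^ 2 + b * w + c = 0) : IsIntegral ℤ ((a : R) * w) := by
  refine ⟨Polynomial.X ^ 2 + Polynomial.C b * Polynomial.X + Polynomial.C (a * c), by monicity!, ?_⟩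
  simp only [Polynomial.eval₂_add, Polynomial.eval₂_mul, Polynomial.eval₂_pow, Polynomial.eval₂_X,
    Polynomial.eval₂_C]
  simp only [eq_intCast, Int.cast_mul]
  linear_combination (a : R) * h

namespace OrientedGenerator

variable {K : Type*} [Field K] [NumberField K] {ι : K →+* ℂ} (G : OrientedGenerator K ι)
  {Q Q' : BinForm}

/-- The zero `ω_Q` of `Q(x, 1)` in the upper half-plane, as an element of `K`; it is sent to
`BinForm.omega` by the embedding of `K` into `ℂ`. -/
def omega (Q : BinForm) : K := (G.δ - Q.b) / (2 * Q.a)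

theorem two_mul_omega (ha : 0 < Q.a) : 2 * (Q.a : K) * G.omega Q = G.δ - Q.b := by
  have : (Q.a : K) ≠ 0 := by exact_mod_cast ha.ne'
  rw [omega]
  field_simp

theorem im_omega_pos (ha : 0 < Q.a) : 0 < (ι (G.omega Q)).im := by
  have h := congrArg Complex.im (congrArg ι (G.two_mul_omega ha))
  have haR : (0 : ℝ) < 2 * Q.a := by exact_mod_cast mul_pos two_pos ha
  rw [map_mul, map_mul, map_intCast, map_ofNat, ← Complex.ofReal_intCast, ← Complex.ofReal_ofNat,
    ← Complex.ofReal_mul, Complex.im_ofReal_mul, map_sub, map_intCast, Complex.sub_im,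
    Complex.intCast_im, sub_zero] at h
  exact pos_of_mul_pos_right (h ▸ G.im_δ_pos) haR.le

theorem omega_root (ha : 0 < Q.a) (hd : Q.disc = discr K) :
    (Q.a : K) * G.omega Q ^ 2 + Q.b * G.omega Q + Q.c = 0 := by
  have h := G.two_mul_omega ha
  have hδ := G.δ_sq
  rw [← hd, BinForm.disc] at hδ
  push_cast at hδ
  have haK : (4 * Q.a : K) ≠ 0 := by exact_mod_cast mul_ne_zero four_ne_zero ha.ne'
  refine (mul_eq_zero.mp ?_).resolve_left haK
  linear_combination (2 * Q.a * G.omega Q + G.δ + Q.b) * h + hδ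

theorem map_omega (ha : 0 < Q.a) (hd : Q.disc = discr K) : ι (G.omega Q) = Q.omega :=
  (Q.omega_spec ha (hd ▸ G.discr_neg) _).mp
    ⟨G.im_omega_pos ha, by simpa using congrArg ι (G.omega_root ha hd)⟩

theorem eq_omega_mul (ha : 0 < Q.a) (hd : Q.disc = discr K) {ξ ν : K}
    (him : 0 < (ι ξ * starRingEnd ℂ (ι ν)).im)
    (hroot : (Q.a * ξ ^ 2 + Q.b * (ξ * ν) + Q.c * ν ^ 2 : K) = 0) : ξ = G.omega Q * ν := by
  have hν : ν ≠ 0 := by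
    rintro rfl
    simp at him
  rw [← div_eq_iff hν]
  apply ι.injective
  rw [G.map_omega ha hd]
  refine (Q.omega_spec ha (hd ▸ G.discr_neg) _).mp ⟨?_, ?_⟩
  · have hdiv : ι (ξ / ν) = ((Complex.normSq (ι ν))⁻¹ : ℝ) * (ι ξ * starRingEnd ℂ (ι ν)) := by
      rw [map_div₀, div_eq_mul_inv, Complex.inv_def]
      ring
    rw [hdiv, Complex.im_ofReal_mul]
    exact mul_pos (inv_pos.mpr (Complex.normSq_pos.mpr (by simpa using hν))) him
  · have hroot' : (Q.a * (ξ / ν) ^ 2 + Q.b * (ξ / ν) + Q.c : K) = 0 := by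
      field_simp
      linear_combination hroot
    simpa only [map_add, map_mul, map_pow, map_intCast, map_zero] using congrArg ι hroot'

theorem exists_a_mul_omega_eq (ha : 0 < Q.a) (hd : Q.disc = discr K) :
    ∃ k : ℤ, (Q.a : K) * G.omega Q = G.θ - k := by
  have heven : Even (Q.b ^ 2 + G.T ^ 2) := by
    rw [G.discr_eq, BinForm.disc] at hd
    exact ⟨G.T ^ 2 - 2 * G.n + 2 * Q.a * Q.c, by linear_combination hd⟩
  obtain ⟨k, hk⟩ : Even (Q.b + G.T) := by simpa [Int.even_add, Int.even_pow] using heven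
  have hk' : (Q.b : K) + G.T = k + k := by exact_mod_cast hk
  have hω := G.two_mul_omega ha
  rw [δ] at hω
  exact ⟨k, mul_left_cancel₀ (two_ne_zero (α := K)) (by linear_combination hω - hk')⟩

theorem int_dvd_one_of_dvd_θ_sub {g k : ℤ} (h : (g : 𝓞 K) ∣ G.θ - k) : g ∣ 1 := by
  obtain ⟨z, hz⟩ := h
  obtain ⟨s, t, rfl⟩ := G.exists_eq_add_mul_θ z
  have hz' := congrArg (algebraMap (𝓞 K) K) hz
  simp only [map_sub, map_add, map_mul, map_intCast] at hz'
  exact ⟨t, (G.isOrientedBasis.coord_inj (s := 1) (t := -k) (s' := g * t) (t' := g * s) (by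
    push_cast
    linear_combination hz')).1⟩

theorem isPrimitive (G : OrientedGenerator K ι) (ha : 0 < Q.a) (hd : Q.disc = discr K) :
    Q.IsPrimitive := by
  have hgcd := Int.gcd_dvd_right Q.a (Int.gcd Q.b Q.c)
  obtain ⟨a, hQa⟩ := Int.gcd_dvd_left Q.a (Int.gcd Q.b Q.c)
  obtain ⟨b, hQb⟩ := hgcd.trans (Int.gcd_dvd_left Q.b Q.c)
  obtain ⟨c, hQc⟩ := hgcd.trans (Int.gcd_dvd_right Q.b Q.c)
  rw [BinForm.IsPrimitive]
  generalize Int.gcd Q.a (Int.gcd Q.b Q.c) = g at hQa hQb hQc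
  have hg : (g : K) ≠ 0 := by
    rintro h
    rw [Nat.cast_eq_zero.mp h, Nat.cast_zero, zero_mul] at hQa
    exact ha.ne' hQa
  have hroot : (a : K) * G.omega Q ^ 2 + b * G.omega Q + c = 0 := by
    have h := G.omega_root ha hd
    rw [hQa, hQb, hQc] at h
    push_cast at h
    exact (mul_eq_zero.mp (by linear_combination h)).resolve_left hg
  obtain ⟨k, hk⟩ := G.exists_a_mul_omega_eq ha hd
  rw [hQa] at hk
  obtain ⟨z, hz⟩ : ∃ z : 𝓞 K, (z : K) = a * G.omega Q :=
    ⟨⟨_, isIntegral_mul_of_quadratic_eq_zero hroot⟩, rfl⟩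
  have hdvd : ((g : ℤ) : 𝓞 K) ∣ G.θ - k := by
    refine ⟨z, RingOfIntegers.coe_injective ?_⟩
    simp only [map_sub, map_mul, map_intCast]
    push_cast at hk ⊢
    linear_combination -hk - (g : K) * hz
  exact Nat.dvd_one.mp (Int.natCast_dvd_natCast.mp (G.int_dvd_one_of_dvd_θ_sub hdvd))

/-- The fractional ideal `[ω_Q, 1]`, written as `ω_Q 𝓞 K + 𝓞 K`. -/
noncomputable def latticeIdeal (Q : BinForm) : FractionalIdeal (𝓞 K)⁰ K :=
  FractionalIdeal.spanSingleton (𝓞 K)⁰ (G.omega Q) + 1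

theorem one_le_latticeIdeal (Q : BinForm) : 1 ≤ G.latticeIdeal Q := by
  rw [latticeIdeal, ← FractionalIdeal.sup_eq_add]
  exact le_sup_right

theorem latticeIdeal_ne_zero (Q : BinForm) : G.latticeIdeal Q ≠ 0 :=
  (zero_lt_one.trans_le (G.one_le_latticeIdeal Q)).ne'

theorem isOrientedBasis_latticeIdeal (ha : 0 < Q.a) (hd : Q.disc = discr K) :
    IsOrientedBasis ι (G.latticeIdeal Q) (G.omega Q) 1 where
  mem_iff x := by
    obtain ⟨k, hk⟩ := G.exists_a_mul_omega_eq ha hd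
    have hroot := G.omega_root ha hd
    rw [latticeIdeal, ← FractionalIdeal.mem_coe, FractionalIdeal.coe_add, Submodule.add_eq_sup,
      Submodule.mem_sup]
    simp only [FractionalIdeal.mem_coe, FractionalIdeal.mem_spanSingleton,
      FractionalIdeal.mem_one_iff]
    constructor
    · rintro ⟨_, ⟨α, rfl⟩, _, ⟨β, rfl⟩, rfl⟩
      obtain ⟨s, t, rfl⟩ := G.exists_eq_add_mul_θ α
      obtain ⟨s', t', rfl⟩ := G.exists_eq_add_mul_θ β
      refine ⟨s + t * (k - Q.b) + t' * Q.a, s' + t' * k - t * Q.c, ?_⟩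
      simp only [Algebra.smul_def, map_add, map_mul, map_intCast]
      push_cast
      linear_combination (t : K) * hroot - (t * G.omega Q + t' : K) * hk
    · rintro ⟨s, t, rfl⟩
      exact ⟨_, ⟨s, rfl⟩, _, ⟨t, rfl⟩, by simp [Algebra.smul_def]⟩
  im_pos := by simpa using G.im_omega_pos ha

theorem image_latticeIdeal (ha : 0 < Q.a) (hd : Q.disc = discr K) :
    ι '' {x : K | x ∈ G.latticeIdeal Q} = (lattice Q.omega : Set ℂ) := by
  ext z
  simp only [Set.mem_image, Set.mem_ofPred_eq, (G.isOrientedBasis_latticeIdeal ha hd).mem_iff,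
    SetLike.mem_coe, lattice, Submodule.mem_span_pair, ← G.map_omega ha hd]
  constructor
  · rintro ⟨_, ⟨s, t, rfl⟩, rfl⟩
    exact ⟨s, t, by simp⟩
  · rintro ⟨s, t, rfl⟩
    exact ⟨_, ⟨s, t, rfl⟩, by simp⟩

theorem isOrientedBasis_latticeIdeal_act_inv (ha : 0 < Q.a) (hd : Q.disc = discr K)
    (σ : SL(2, ℤ)) : IsOrientedBasis ι (G.latticeIdeal Q)
      (σ 1 1 * G.omega Q - σ 0 1) (σ 0 0 - σ 1 0 * G.omega Q) := by
  simpa [Matrix.SpecialLinearGroup.SL2_inv_expl, sub_eq_add_neg, add_comm] using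
    (G.isOrientedBasis_latticeIdeal ha hd).act σ⁻¹

theorem automorphy_mul (hQ : Q.IsPosDef) (hd : Q.disc = discr K) (σ : SL(2, ℤ)) :
    σ 1 1 * G.omega Q - σ 0 1 = G.omega (Q.act σ) * (σ 0 0 - σ 1 0 * G.omega Q) ∧
    (σ 1 0 * G.omega (Q.act σ) + σ 1 1) * (σ 0 0 - σ 1 0 * G.omega Q) = 1 := by
  have hdet := SL2_det_cast (R := K) σ
  have hω := G.eq_omega_mul (hQ.act σ).a_pos ((Q.disc_act σ).trans hd)
    (G.isOrientedBasis_latticeIdeal_act_inv hQ.a_pos hd σ).im_pos (by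
      rw [Q.act_eval_cast]
      linear_combination ((σ 0 0 : K) * σ 1 1 - σ 0 1 * σ 1 0 + 1) *
        (Q.a * G.omega Q ^ 2 + Q.b * G.omega Q + Q.c) * hdet + G.omega_root hQ.a_pos hd)
  exact ⟨hω, by linear_combination hdet - σ 1 0 * hω⟩

theorem latticeIdeal_act (hQ : Q.IsPosDef) (hd : Q.disc = discr K) (σ : SL(2, ℤ)) :
    G.latticeIdeal (Q.act σ) =
      FractionalIdeal.spanSingleton (𝓞 K)⁰ (σ 1 0 * G.omega (Q.act σ) + σ 1 1 : K) *
        G.latticeIdeal Q := by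
  obtain ⟨hω, hj⟩ := G.automorphy_mul hQ hd σ
  have hbasis := (G.isOrientedBasis_latticeIdeal_act_inv hQ.a_pos hd σ).smul
    (left_ne_zero_of_mul_eq_one hj)
  rw [hω, mul_left_comm, hj, mul_one] at hbasis
  exact (G.isOrientedBasis_latticeIdeal (hQ.act σ).a_pos ((Q.disc_act σ).trans hd)).eq_of_mem hbasis

theorem eq_of_omega_eq (ha : 0 < Q.a) (hd : Q.disc = discr K) (ha' : 0 < Q'.a)
    (hd' : Q'.disc = discr K) (h : G.omega Q = G.omega Q') : Q = Q' := by
  have hω := G.two_mul_omega ha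
  have hω' := G.two_mul_omega ha'
  rw [← h] at hω'
  obtain ⟨h2a, hb⟩ := (G.isOrientedBasis_latticeIdeal ha hd).coord_inj (s := 2 * Q.a) (t := Q.b)
    (s' := 2 * Q'.a) (t' := Q'.b) (by push_cast; linear_combination hω - hω')
  have haa : Q.a = Q'.a := mul_left_cancel₀ two_ne_zero h2a
  have hc : Q.c = Q'.c := by
    rw [← hd', BinForm.disc, BinForm.disc, hb, haa] at hd
    exact mul_left_cancel₀ (mul_ne_zero four_ne_zero ha'.ne') (by linear_combination -hd)
  exact BinForm.ext haa hb hc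

theorem exists_act_eq_of_latticeIdeal_eq (hQ : Q.IsPosDef) (hd : Q.disc = discr K)
    (hQ' : Q'.IsPosDef) (hd' : Q'.disc = discr K) {l : K} (hl : l ≠ 0)
    (h : G.latticeIdeal Q' = FractionalIdeal.spanSingleton (𝓞 K)⁰ l * G.latticeIdeal Q) :
    ∃ σ : SL(2, ℤ), Q' = Q.act σ ∧ l = σ 1 0 * G.omega Q' + σ 1 1 := by
  have hbasis := (G.isOrientedBasis_latticeIdeal hQ.a_pos hd).smul hl
  rw [← h] at hbasis
  have hbasis' := G.isOrientedBasis_latticeIdeal hQ'.a_pos hd'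
  obtain ⟨σ, hξ, hν⟩ := hbasis'.exists_SL2 hbasis
  refine ⟨σ, G.eq_of_omega_eq hQ'.a_pos hd' (hQ.act σ).a_pos ((Q.disc_act σ).trans hd) ?_,
    by linear_combination hν⟩
  have hω := G.eq_omega_mul (hQ.act σ).a_pos ((Q.disc_act σ).trans hd) hbasis'.im_pos (by
    rw [Q.act_eval_cast, ← hξ, ← hν]
    linear_combination l ^ 2 * G.omega_root hQ.a_pos hd)
  rwa [mul_one] at hω

theorem exists_form_of_isOrientedBasis {J : FractionalIdeal (𝓞 K)⁰ K} {ξ ν : K}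
    (h : IsOrientedBasis ι J ξ ν) : ∃ Q : BinForm, 0 < Q.a ∧ Q.disc = discr K ∧
      ξ = G.omega Q * ν := by
  have hmul : ∀ x ∈ J, (G.θ : K) * x ∈ J := fun x hx =>
    (J : Submodule (𝓞 K) K).smul_mem G.θ hx
  obtain ⟨a, k, hν⟩ := (h.mem_iff _).mp (hmul ν h.right_mem)
  obtain ⟨p, q, hξ⟩ := (h.mem_iff _).mp (hmul ξ h.left_mem)
  have hnorm : (G.θ - p : K) * (G.θ - k) = a * q :=
    mul_right_cancel₀ h.ne_zero (by linear_combination (G.θ - p : K) * hν + a * hξ)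
  obtain ⟨htr, hn⟩ := G.isOrientedBasis.coord_inj (s := G.T - p - k) (t := p * k - G.n)
    (s' := 0) (t' := a * q) (by push_cast; linear_combination hnorm - G.θ_sq)
  have ha : 0 < a := by
    have him := im_map_mul_mul_conj (ι := ι) G.θ ν
    rw [hν, im_map_combination_mul_conj] at him
    have hpos : 0 < Complex.normSq (ι ν) * (ι G.θ).im :=
      mul_pos (Complex.normSq_pos.mpr (by simpa using h.ne_zero)) G.im_θ_pos
    exact_mod_cast pos_of_mul_pos_left (him ▸ hpos) h.im_pos.le
  have hd : BinForm.disc ⟨a, k - p, -q⟩ = discr K := by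
    rw [G.discr_eq, BinForm.disc]
    linear_combination -(G.T + p + k) * htr - 4 * hn
  exact ⟨⟨a, k - p, -q⟩, ha, hd, G.eq_omega_mul ha hd h.im_pos (by
    push_cast
    linear_combination ν * hξ - ξ * hν)⟩

end OrientedGenerator

section DedekindDomain

open IsDedekindDomain

theorem exists_heightOneSpectrum_of_not_isCoprime {R : Type*} [CommRing R] {A 𝔫 : Ideal R}
    (h𝔫 : 𝔫 ≠ ⊥) (h : ¬ IsCoprime A 𝔫) :
    ∃ v : HeightOneSpectrum R, A ≤ v.asIdeal ∧ 𝔫 ≤ v.asIdeal := by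
  rw [Ideal.isCoprime_iff_sup_eq] at h
  obtain ⟨M, hM, hle⟩ := Ideal.exists_le_maximal _ h
  exact ⟨⟨M, hM.isPrime, fun h0 => h𝔫 (le_bot_iff.mp (h0 ▸ le_sup_right.trans hle))⟩,
    le_sup_left.trans hle, le_sup_right.trans hle⟩

variable {R : Type*} [CommRing R] [IsDedekindDomain R] {F : Type*} [Field F] [Algebra R F]
  [IsFractionRing R F]

theorem count_coeIdeal_eq_zero_iff (v : HeightOneSpectrum R) {J : Ideal R} (hJ : J ≠ ⊥) :
    FractionalIdeal.count F v (J : FractionalIdeal R⁰ F) = 0 ↔ ¬ J ≤ v.asIdeal := by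
  classical
  rw [FractionalIdeal.count_coe F v hJ, Nat.cast_eq_zero, ← Ideal.dvd_iff_le, ← not_iff_not,
    not_not]
  exact Associates.count_ne_zero_iff_dvd hJ v.irreducible

theorem exists_isCoprime_mul_coeIdeal_eq {I : FractionalIdeal R⁰ F} (hI : I ≠ 0) :
    ∃ A B : Ideal R, A ≠ ⊥ ∧ B ≠ ⊥ ∧ IsCoprime A B ∧ I * (B : FractionalIdeal R⁰ F) = A := by
  obtain ⟨a, J, ha, hIJ⟩ := FractionalIdeal.exists_eq_spanSingleton_mul I
  obtain ⟨A, B, hA, hB, hAB⟩ := extract_gcd J (Ideal.span {a})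
  generalize gcd J (Ideal.span {a}) = g at hA hB
  have hspan : Ideal.span {a} ≠ ⊥ := by simpa using ha
  obtain ⟨hg, hB0⟩ := mul_ne_zero_iff.mp (hB ▸ hspan)
  have hIaJ : I * (Ideal.span {a} : Ideal R) = (J : FractionalIdeal R⁰ F) := by
    rw [hIJ, FractionalIdeal.coeIdeal_span_singleton, mul_right_comm,
      FractionalIdeal.spanSingleton_mul_spanSingleton, inv_mul_cancel₀ (by simpa using ha),
      FractionalIdeal.spanSingleton_one, one_mul]
  have hIBA : I * (B : FractionalIdeal R⁰ F) = A := by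
    refine mul_left_cancel₀ (FractionalIdeal.coeIdeal_ne_zero.mpr hg) ?_
    rw [← FractionalIdeal.coeIdeal_mul, ← hA, ← hIaJ, hB, FractionalIdeal.coeIdeal_mul]
    ring
  refine ⟨A, B, ?_, hB0, Ideal.isCoprime_iff_gcd.mpr ?_, hIBA⟩
  · rw [← FractionalIdeal.coeIdeal_ne_zero (K := F), ← hIBA]
    exact mul_ne_zero hI (FractionalIdeal.coeIdeal_ne_zero.mpr hB0)
  · rw [← normalize_gcd A B]
    exact normalize_eq_one.mpr hAB

theorem exists_mul_coeIdeal_eq_of_count_eq_zero {𝔫 : Ideal R} (h𝔫 : 𝔫 ≠ ⊥)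
    {I : FractionalIdeal R⁰ F} (hI : I ≠ 0)
    (h : ∀ v : HeightOneSpectrum R, v.asIdeal ∣ 𝔫 → FractionalIdeal.count F v I = 0) :
    ∃ A B : Ideal R, A ≠ ⊥ ∧ B ≠ ⊥ ∧ IsCoprime A 𝔫 ∧ IsCoprime B 𝔫 ∧
      I * (B : FractionalIdeal R⁰ F) = A := by
  obtain ⟨A, B, hA, hB, hAB, hIBA⟩ := exists_isCoprime_mul_coeIdeal_eq hI
  have hiff : ∀ v : HeightOneSpectrum R, 𝔫 ≤ v.asIdeal → (A ≤ v.asIdeal ↔ B ≤ v.asIdeal) := by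
    intro v hv
    rw [← not_iff_not, ← count_coeIdeal_eq_zero_iff (F := F) v hA,
      ← count_coeIdeal_eq_zero_iff (F := F) v hB, ← hIBA,
      FractionalIdeal.count_mul F v hI (FractionalIdeal.coeIdeal_ne_zero.mpr hB),
      h v (Ideal.dvd_iff_le.mpr hv), zero_add]
  have hnot : ∀ v : HeightOneSpectrum R, A ≤ v.asIdeal → ¬ B ≤ v.asIdeal := fun v hAv hBv =>
    v.isPrime.ne_top (top_le_iff.mp (Ideal.isCoprime_iff_sup_eq.mp hAB ▸ sup_le hAv hBv))
  refine ⟨A, B, hA, hB, ?_, ?_, hIBA⟩ <;> by_contra hcop <;>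
    obtain ⟨v, hv, h𝔫v⟩ := exists_heightOneSpectrum_of_not_isCoprime h𝔫 hcop
  · exact hnot v hv ((hiff v h𝔫v).mp hv)
  · exact hnot v ((hiff v h𝔫v).mpr hv) hv

end DedekindDomain

section RayClass

theorem isCoprime_span_singleton_of_sub_mem {R : Type*} [CommRing R] {𝔫 : Ideal R} {α β : R}
    (hβ : IsCoprime (Ideal.span {β}) 𝔫) (h : α - β ∈ 𝔫) : IsCoprime (Ideal.span {α}) 𝔫 := by
  obtain ⟨c, hc, d, hd, hcd⟩ := Ideal.isCoprime_iff_exists.mp hβ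
  obtain ⟨z, rfl⟩ := Ideal.mem_span_singleton.mp hc
  exact Ideal.isCoprime_iff_exists.mpr ⟨z * α, Ideal.mem_span_singleton'.mpr ⟨z, rfl⟩,
    d - z * (α - β), 𝔫.sub_mem hd (𝔫.mul_mem_left _ h), by linear_combination hcd⟩

theorem isCoprime_span_natCast_of_modEq_one (R : Type*) [CommRing R] {m N : ℕ}
    (hm : m ≡ 1 [MOD N]) : IsCoprime (Ideal.span {(m : R)}) (Ideal.span {(N : R)}) := by
  rw [Ideal.isCoprime_span_singleton_iff]
  have := (Nat.isCoprime_iff_coprime.mpr (hm.gcd_eq.trans (Nat.gcd_one_left N))).map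
    (Int.castRingHom R)
  simpa using this

variable {K : Type*} [Field K] [NumberField K]

theorem mk_eq_mk_iff {𝔫 : Ideal (𝓞 K)} (A B : idealsPrimeTo K 𝔫) :
    (QuotientGroup.mk A : RayClassGroup K 𝔫) = QuotientGroup.mk B ↔
      ∃ l ∈ congrOne K 𝔫, ((B : (FractionalIdeal (𝓞 K)⁰ K)ˣ) : FractionalIdeal (𝓞 K)⁰ K) =
        FractionalIdeal.spanSingleton (𝓞 K)⁰ (l : K) *
          ((A : (FractionalIdeal (𝓞 K)⁰ K)ˣ) : FractionalIdeal (𝓞 K)⁰ K) := by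
  rw [QuotientGroup.eq, Subgroup.mem_subgroupOf, rayPrincipal, Subgroup.mem_map]
  refine exists_congr fun l => and_congr_right fun _ => ?_
  rw [← coe_toPrincipalIdeal, ← Units.val_mul, ← Units.ext_iff, Subgroup.coe_mul,
    Subgroup.coe_inv, eq_inv_mul_iff_mul_eq, mul_comm, eq_comm]

theorem mem_idealsPrimeTo_of_mul_le_one {𝔫 : Ideal (𝓞 K)} {I : (FractionalIdeal (𝓞 K)⁰ K)ˣ}
    {m : 𝓞 K} (hm : m ≠ 0) (hm𝔫 : IsCoprime (Ideal.span {m}) 𝔫)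
    (hI : 1 ≤ (I : FractionalIdeal (𝓞 K)⁰ K))
    (hmI : FractionalIdeal.spanSingleton (𝓞 K)⁰ (m : K) * I ≤ 1) : I ∈ idealsPrimeTo K 𝔫 := by
  intro v hv
  have hspan : Ideal.span {m} ≠ ⊥ := by simpa using hm
  have hmv : ¬ Ideal.span {m} ≤ v.asIdeal := fun h => v.isPrime.ne_top
    (top_le_iff.mp (Ideal.isCoprime_iff_sup_eq.mp hm𝔫 ▸ sup_le h (Ideal.dvd_iff_le.mp hv)))
  have hcount := (count_coeIdeal_eq_zero_iff (F := K) v hspan).mpr hmv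
  have hspan' : ((Ideal.span {m} : Ideal (𝓞 K)) : FractionalIdeal (𝓞 K)⁰ K) ≠ 0 :=
    FractionalIdeal.coeIdeal_ne_zero.mpr hspan
  rw [← FractionalIdeal.coeIdeal_span_singleton] at hmI
  apply le_antisymm
  · rw [← FractionalIdeal.count_one K v]
    exact FractionalIdeal.count_mono K v one_ne_zero hI
  · have := FractionalIdeal.count_mono K v (mul_ne_zero hspan' I.ne_zero) hmI
    rwa [FractionalIdeal.count_mul K v hspan' I.ne_zero, hcount, zero_add,
      FractionalIdeal.count_one] at this

theorem mem_congrOne_of_eq_mul {𝔫 : Ideal (𝓞 K)} {l : Kˣ} {α β : 𝓞 K} (hβ : β ≠ 0)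
    (hβ𝔫 : IsCoprime (Ideal.span {β}) 𝔫) (hαβ : α - β ∈ 𝔫) (h : (α : K) = β * l) :
    l ∈ congrOne K 𝔫 := by
  have hβK : (β : K) ≠ 0 := by simpa using hβ
  refine ⟨α, β, ?_, hβ, isCoprime_span_singleton_of_sub_mem hβ𝔫 hαβ, hβ𝔫, hαβ, ?_⟩
  · rintro rfl
    simp [hβK] at h
  · rw [h, mul_div_cancel_left₀ _ hβK]

theorem exists_nat_mem_of_isCoprime {A : Ideal (𝓞 K)} (hA : A ≠ ⊥) {N : ℕ}
    (h : IsCoprime A (Ideal.span {(N : 𝓞 K)})) :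
    ∃ m : ℕ, m ≠ 0 ∧ m ≡ 1 [MOD N] ∧ (m : 𝓞 K) ∈ A := by
  have : Finite (𝓞 K ⧸ A) := A.finiteQuotientOfFreeOfNeBot hA
  obtain ⟨b, hb, c, hc, hbc⟩ := Ideal.isCoprime_iff_exists.mp h
  obtain ⟨z, rfl⟩ := Ideal.mem_span_singleton.mp hc
  have hunit : IsUnit (N : 𝓞 K ⧸ A) := by
    refine .of_mul_eq_one (Ideal.Quotient.mk A z) ?_
    have := congrArg (Ideal.Quotient.mk A) hbc
    simpa [Ideal.Quotient.eq_zero_iff_mem.mpr hb] using this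
  obtain ⟨e, he, hpow⟩ : ∃ e ≠ 0, (N : 𝓞 K ⧸ A) ^ e = 1 := by
    obtain ⟨u, hu⟩ := hunit
    exact ⟨Nat.card (𝓞 K ⧸ A)ˣ, Nat.card_pos.ne', by
      rw [← hu, ← Units.val_pow_eq_pow_val, pow_card_eq_one', Units.val_one]⟩
  obtain ⟨n, hn⟩ := Nat.exists_eq_succ_of_ne_zero (mt Ideal.absNorm_eq_zero_iff.mp hA)
  refine ⟨1 + N ^ e * n, by positivity, ?_, ?_⟩
  · simpa using (Nat.ModEq.refl 1).add
      (Nat.modEq_zero_iff_dvd.mpr ((dvd_pow_self N he).mul_right n))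
  · have hnorm := Ideal.Quotient.eq_zero_iff_mem.mpr A.absNorm_mem
    rw [hn] at hnorm
    rw [← Ideal.Quotient.eq_zero_iff_mem, ← hnorm]
    simp [hpow, add_comm]

theorem exists_nat_mul_le_one_of_mem_idealsPrimeTo {N : ℕ} (hN : N ≠ 0)
    {I : (FractionalIdeal (𝓞 K)⁰ K)ˣ} (hI : I ∈ idealsPrimeTo K (Ideal.span {(N : 𝓞 K)})) :
    ∃ m n : ℕ, m ≠ 0 ∧ m ≡ 1 [MOD N] ∧ n ≡ 1 [MOD N] ∧
      FractionalIdeal.spanSingleton (𝓞 K)⁰ (m : K) * I ≤ 1 ∧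
      (n : K) ∈ FractionalIdeal.spanSingleton (𝓞 K)⁰ (m : K) * (I : FractionalIdeal _ K) := by
  obtain ⟨A, B, hA, hB, hAN, hBN, hIBA⟩ :=
    exists_mul_coeIdeal_eq_of_count_eq_zero (by simpa using hN) I.ne_zero hI
  obtain ⟨m, hm0, hm, hmB⟩ := exists_nat_mem_of_isCoprime hB hBN
  obtain ⟨n, -, hn, hnA⟩ := exists_nat_mem_of_isCoprime hA hAN
  have hmB' : FractionalIdeal.spanSingleton (𝓞 K)⁰ (m : K) ≤ B := by
    rw [FractionalIdeal.spanSingleton_le_iff_mem]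
    exact (FractionalIdeal.mem_coeIdeal _).mpr ⟨m, hmB, by simp⟩
  have hAI : (A : FractionalIdeal (𝓞 K)⁰ K) ≤ I := by
    rw [← hIBA]
    exact mul_le_of_le_one_right' FractionalIdeal.coeIdeal_le_one
  refine ⟨m, m * n, hm0, hm, by simpa using hm.mul hn, ?_, ?_⟩
  · calc _ ≤ (B : FractionalIdeal (𝓞 K)⁰ K) * I := mul_le_mul_left hmB' _
      _ = A := by rw [mul_comm, hIBA]
      _ ≤ 1 := FractionalIdeal.coeIdeal_le_one
  · exact FractionalIdeal.mem_singleton_mul.mpr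
      ⟨n, hAI ((FractionalIdeal.mem_coeIdeal _).mpr ⟨n, hnA, by simp⟩), by push_cast; rfl⟩

theorem mem_congrOne_of_eq_one_add_mul {N : ℕ} (hN : N ≠ 0) {I : (FractionalIdeal (𝓞 K)⁰ K)ˣ}
    (hI : I ∈ idealsPrimeTo K (Ideal.span {(N : 𝓞 K)})) {l : Kˣ} {y : K}
    (hy : y ∈ (I : FractionalIdeal (𝓞 K)⁰ K)) (hl : (l : K) = 1 + N * y) :
    l ∈ congrOne K (Ideal.span {(N : 𝓞 K)}) := by
  obtain ⟨m, -, hm0, hm, -, hmI, -⟩ := exists_nat_mul_le_one_of_mem_idealsPrimeTo hN hI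
  obtain ⟨z, hz⟩ := (FractionalIdeal.mem_one_iff _).mp
    (hmI (FractionalIdeal.mem_singleton_mul.mpr ⟨y, hy, rfl⟩))
  refine mem_congrOne_of_eq_mul (α := m + N * z) (β := m) (by exact_mod_cast hm0)
    (isCoprime_span_natCast_of_modEq_one _ hm) (Ideal.mem_span_singleton.mpr ⟨z, by ring⟩) ?_
  simp only [map_add, map_mul, map_natCast]
  rw [hl]
  linear_combination (N : K) * hz

theorem exists_mem_eq_one_add_mul_of_mem_congrOne {N : ℕ} {I : FractionalIdeal (𝓞 K)⁰ K}
    (hI : 1 ≤ I) {l : Kˣ} (hlI : (l : K) ∈ I) (hl : l ∈ congrOne K (Ideal.span {(N : 𝓞 K)})) :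
    ∃ y ∈ I, (l : K) = 1 + N * y := by
  obtain ⟨α, β, -, hβ, -, hβN, hαβ, hl⟩ := hl
  have hβK : (β : K) ≠ 0 := by simpa using hβ
  obtain ⟨z, hz⟩ := Ideal.mem_span_singleton.mp hαβ
  obtain ⟨c, d, hcd⟩ := (Ideal.isCoprime_span_singleton_iff _ _).mp hβN
  have hz' : (α : K) - β = N * z := by simpa using congrArg (algebraMap (𝓞 K) K) hz
  have hcd' : (c : K) * β + d * N = 1 := by simpa using congrArg (algebraMap (𝓞 K) K) hcd
  have hlβ : (l : K) - 1 = N * (z / β) := by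
    rw [hl]
    field_simp
    exact hz'
  -- `z / β = c z + d (l - 1)`, and both summands lie in `I`
  refine ⟨z / β, ?_, by linear_combination hlβ⟩
  have hy : (z / β : K) = c • (z : K) + d • ((l : K) - 1) := by
    rw [Algebra.smul_def, Algebra.smul_def, hlβ]
    field_simp
    linear_combination -(z : K) * hcd'
  rw [hy]
  have h1 : (1 : K) ∈ I := hI (FractionalIdeal.one_mem_one _)
  exact (I : Submodule (𝓞 K) K).add_mem
    ((I : Submodule (𝓞 K) K).smul_mem c (hI (FractionalIdeal.coe_mem_one _ z)))
    ((I : Submodule (𝓞 K) K).smul_mem d ((I : Submodule (𝓞 K) K).sub_mem hlI h1))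

end RayClass

theorem mem_Gamma1_iff_dvd {N : ℕ} {σ : SL(2, ℤ)} :
    σ ∈ CongruenceSubgroup.Gamma1 N ↔ (N : ℤ) ∣ σ 1 0 ∧ (N : ℤ) ∣ σ 1 1 - 1 := by
  have hone : ∀ x : ℤ, (x : ZMod N) = 1 ↔ (N : ℤ) ∣ x - 1 := fun x => by
    rw [← ZMod.intCast_zmod_eq_zero_iff_dvd, Int.cast_sub, Int.cast_one, sub_eq_zero]
  rw [CongruenceSubgroup.Gamma1_mem, hone, hone, ZMod.intCast_zmod_eq_zero_iff_dvd]
  refine ⟨fun h => ⟨h.2.2, h.2.1⟩, fun h => ⟨?_, h.2, h.1⟩⟩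
  have hdet := SL2_det_cast (R := ℤ) σ
  simp only [Int.cast_id] at hdet
  have : σ 0 0 - 1 = σ 0 1 * σ 1 0 - σ 0 0 * (σ 1 1 - 1) := by linear_combination hdet
  rw [this]
  exact dvd_sub (h.1.mul_left _) (h.2.mul_left _)

theorem exists_mem_pmGamma1_act_eq_iff {N : ℕ} {Q Q' : BinForm} :
    (∃ σ ∈ pmGamma1 N, Q' = Q.act σ) ↔ ∃ σ ∈ CongruenceSubgroup.Gamma1 N, Q' = Q.act σ := by
  constructor
  · rintro ⟨σ, hσ | hσ, h⟩
    · exact ⟨σ, hσ, h⟩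
    · exact ⟨-σ, hσ, by rw [BinForm.act_neg, h]⟩
  · rintro ⟨σ, hσ, h⟩
    exact ⟨σ, Or.inl hσ, h⟩

theorem IsOrientedBasis.exists_right_eq_one_add_mul {K : Type*} [Field K] [NumberField K]
    {ι : K →+* ℂ} {J : FractionalIdeal (𝓞 K)⁰ K} {e₁ e₂ : K} (he : IsOrientedBasis ι J e₁ e₂)
    (hJ : J ≤ 1) {N n : ℕ} (hN : N ≠ 0) (hn : n ≡ 1 [MOD N]) (hnJ : (n : K) ∈ J) :
    ∃ ξ ν w : 𝓞 K, IsOrientedBasis ι J (ξ : K) ν ∧ ν = 1 + N * w := by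
  obtain ⟨x, y, hxy⟩ := (he.mem_iff _).mp hnJ
  obtain ⟨α, rfl⟩ := (FractionalIdeal.mem_one_iff _).mp (hJ he.left_mem)
  obtain ⟨β, rfl⟩ := (FractionalIdeal.mem_one_iff _).mp (hJ he.right_mem)
  have hnxy : (n : 𝓞 K) = x * α + y * β := RingOfIntegers.coe_injective (by simpa using hxy)
  have hcop : IsCoprime (Int.gcd x y : ℤ) N := by
    apply isCoprime_of_isCoprime_cast (K := K)
    have hnN := (Ideal.isCoprime_span_singleton_iff _ _).mp
      (isCoprime_span_natCast_of_modEq_one (𝓞 K) hn)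
    rw [Int.cast_natCast N]
    refine hnN.of_isCoprime_of_dvd_left (hnxy ▸ dvd_add ?_ ?_) <;>
      refine Dvd.dvd.mul_right ?_ _ <;> apply Int.cast_dvd_cast
    · exact Int.gcd_dvd_left ..
    · exact Int.gcd_dvd_right ..
  obtain ⟨σ, hx, hy⟩ := exists_SL2_row_modEq (by exact_mod_cast hN) hcop
  obtain ⟨s, hs⟩ := hx.symm.dvd
  obtain ⟨t, ht⟩ := hy.symm.dvd
  obtain ⟨r, hr⟩ := (Int.natCast_modEq_iff.mpr hn).symm.dvd
  rw [sub_eq_iff_eq_add] at hs ht hr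
  refine ⟨σ 0 0 * α + σ 0 1 * β, σ 1 0 * α + σ 1 1 * β, r + s * α + t * β, ?_, ?_⟩
  · simpa using he.act σ
  · have hr' : (n : 𝓞 K) = N * r + 1 := by exact_mod_cast congrArg (Int.cast (R := 𝓞 K)) hr
    rw [hs, ht]
    push_cast
    linear_combination hr' - hnxy

namespace OrientedGenerator

variable {K : Type*} [Field K] [NumberField K] {ι : K →+* ℂ} (G : OrientedGenerator K ι) {N : ℕ}

theorem a_mul_latticeIdeal_le_one {Q : BinForm} (ha : 0 < Q.a) (hd : Q.disc = discr K) :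
    FractionalIdeal.spanSingleton (𝓞 K)⁰ (Q.a : K) * G.latticeIdeal Q ≤ 1 := by
  obtain ⟨k, hk⟩ := G.exists_a_mul_omega_eq ha hd
  rw [latticeIdeal, mul_add, FractionalIdeal.spanSingleton_mul_spanSingleton, hk, mul_one,
    ← FractionalIdeal.sup_eq_add, sup_le_iff, FractionalIdeal.spanSingleton_le_iff_mem,
    FractionalIdeal.spanSingleton_le_iff_mem]
  exact ⟨(FractionalIdeal.mem_one_iff _).mpr ⟨G.θ - k, by simp⟩,
    (FractionalIdeal.mem_one_iff _).mpr ⟨Q.a, by simp⟩⟩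

/-- The lattice `[ω_Q, 1]` as a fractional ideal prime to `N`. -/
noncomputable def idealOfForm (Q : FormsPrimeTo N (discr K)) :
    idealsPrimeTo K (Ideal.span {(N : 𝓞 K)}) :=
  ⟨Units.mk0 (G.latticeIdeal Q.1) (G.latticeIdeal_ne_zero Q.1), by
    obtain ⟨-, hpos, hd, hgcd⟩ := Q.2
    have hcop : IsCoprime (Q.1.a : 𝓞 K) N := by
      simpa using (Int.isCoprime_iff_gcd_eq_one.mpr hgcd).symm.map (Int.castRingHom (𝓞 K))
    exact mem_idealsPrimeTo_of_mul_le_one (m := (Q.1.a : 𝓞 K))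
      (Int.cast_ne_zero.mpr hpos.a_pos.ne') ((Ideal.isCoprime_span_singleton_iff _ _).mpr hcop)
      (G.one_le_latticeIdeal Q.1) (by simpa using G.a_mul_latticeIdeal_le_one hpos.a_pos hd)⟩

theorem mem_congrOne_iff_dvd (Q : FormsPrimeTo N (discr K)) {u v : ℤ} {l : Kˣ}
    (hl : (l : K) = u * G.omega Q.1 + v) :
    l ∈ congrOne K (Ideal.span {(N : 𝓞 K)}) ↔ (N : ℤ) ∣ u ∧ (N : ℤ) ∣ v - 1 := by
  obtain ⟨-, hpos, hd, -⟩ := Q.2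
  have hbasis := G.isOrientedBasis_latticeIdeal hpos.a_pos hd
  constructor
  · intro hmem
    obtain ⟨y, hy, hly⟩ := exists_mem_eq_one_add_mul_of_mem_congrOne (G.one_le_latticeIdeal Q.1)
      ((hbasis.mem_iff _).mpr ⟨u, v, by rw [hl, mul_one]⟩) hmem
    obtain ⟨s, t, rfl⟩ := (hbasis.mem_iff y).mp hy
    obtain ⟨hu, hv⟩ := hbasis.coord_inj (s := u) (t := v) (s' := N * s) (t' := 1 + N * t) (by
      push_cast
      linear_combination hly - hl)
    exact ⟨⟨s, hu⟩, ⟨t, by rw [hv, add_sub_cancel_left]⟩⟩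
  · rintro ⟨⟨s, rfl⟩, ⟨t, ht⟩⟩
    obtain rfl : v = 1 + N * t := by rw [← ht, add_sub_cancel]
    have hl' : (l : K) = 1 + N * (s * G.omega Q.1 + t) := by
      rw [hl]
      push_cast
      ring
    rcases eq_or_ne N 0 with rfl | hN
    · obtain rfl : l = 1 := Units.ext (by simpa using hl')
      exact one_mem _
    · exact mem_congrOne_of_eq_one_add_mul hN (G.idealOfForm Q).2
        ((hbasis.mem_iff _).mpr ⟨s, t, by rw [mul_one]⟩) hl'

theorem mk_idealOfForm_eq_iff (Q Q' : FormsPrimeTo N (discr K)) :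
    (QuotientGroup.mk (G.idealOfForm Q) : RayClassGroup K (Ideal.span {(N : 𝓞 K)})) =
      QuotientGroup.mk (G.idealOfForm Q') ↔ ∃ σ ∈ pmGamma1 N, Q'.1 = Q.1.act σ := by
  obtain ⟨-, hpos, hd, -⟩ := Q.2
  obtain ⟨-, hpos', hd', -⟩ := Q'.2
  rw [mk_eq_mk_iff, exists_mem_pmGamma1_act_eq_iff]
  constructor
  · rintro ⟨l, hl, h⟩
    obtain ⟨σ, hσ, hlσ⟩ := G.exists_act_eq_of_latticeIdeal_eq hpos hd hpos' hd' l.ne_zero h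
    exact ⟨σ, mem_Gamma1_iff_dvd.mpr ((G.mem_congrOne_iff_dvd Q' hlσ).mp hl), hσ⟩
  · rintro ⟨σ, hσ, h⟩
    have hj := left_ne_zero_of_mul_eq_one (G.automorphy_mul hpos hd σ).2
    rw [← h] at hj
    refine ⟨Units.mk0 _ hj, (G.mem_congrOne_iff_dvd Q' rfl).mpr (mem_Gamma1_iff_dvd.mp hσ), ?_⟩
    have hact := G.latticeIdeal_act hpos hd σ
    rw [← h] at hact
    exact hact

/-- The map `φ_N` sending the class of a form `Q` to the ray class of `[ω_Q, 1]`. -/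
noncomputable def classMap (N : ℕ) :
    FormClass N (discr K) → RayClassGroup K (Ideal.span {(N : 𝓞 K)}) :=
  Quotient.lift (fun Q => QuotientGroup.mk (G.idealOfForm Q))
    fun Q Q' h => (G.mk_idealOfForm_eq_iff Q Q').mpr h

theorem classMap_injective : Function.Injective (G.classMap N) := by
  rintro ⟨Q⟩ ⟨Q'⟩ h
  exact Quotient.sound ((G.mk_idealOfForm_eq_iff Q Q').mp h)

theorem isCoprime_a_of_eq_omega_mul {Q : BinForm} (ha : 0 < Q.a) (hd : Q.disc = discr K)
    {ξ ν : 𝓞 K} (hν : IsCoprime ν (N : 𝓞 K)) (h : (ξ : K) = G.omega Q * ν) :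
    IsCoprime Q.a (N : ℤ) := by
  obtain ⟨k, hk⟩ := G.exists_a_mul_omega_eq ha hd
  have hξ : (Q.a : 𝓞 K) * ξ = ν * (G.θ - k) := by
    apply RingOfIntegers.coe_injective
    simp only [map_mul, map_sub, map_intCast]
    linear_combination (ν : K) * hk + (Q.a : K) * h
  have hgN : ((Int.gcd Q.a N : ℤ) : 𝓞 K) ∣ N := by
    exact_mod_cast Int.cast_dvd_cast (α := 𝓞 K) _ _ (Int.gcd_dvd_right Q.a N)
  have hgν : ((Int.gcd Q.a N : ℤ) : 𝓞 K) ∣ ν * (G.θ - k) :=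
    hξ ▸ (Int.cast_dvd_cast _ _ (Int.gcd_dvd_left Q.a N)).mul_right ξ
  have hgθ := (hν.of_isCoprime_of_dvd_right hgN).symm.dvd_of_dvd_mul_left hgν
  rw [Int.isCoprime_iff_gcd_eq_one]
  exact Nat.dvd_one.mp (Int.natCast_dvd_natCast.mp (G.int_dvd_one_of_dvd_θ_sub hgθ))

theorem classMap_surjective [Algebra.IsQuadraticExtension ℚ K] [IsTotallyComplex K]
    (hN : N ≠ 0) : Function.Surjective (G.classMap N) := by
  intro c
  obtain ⟨I, rfl⟩ := QuotientGroup.mk_surjective c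
  obtain ⟨m, n, hm0, hm, hn, hJ, hnJ⟩ := exists_nat_mul_le_one_of_mem_idealsPrimeTo hN I.2
  have hmK : (m : K) ≠ 0 := by exact_mod_cast hm0
  obtain ⟨e₁, e₂, he⟩ := exists_isOrientedBasis ι
    (mul_ne_zero (FractionalIdeal.spanSingleton_ne_zero_iff.mpr hmK) I.1.ne_zero)
  obtain ⟨ξ, ν, w, hbasis, hν⟩ := he.exists_right_eq_one_add_mul hJ hN hn hnJ
  obtain ⟨Q, ha, hd, hξ⟩ := G.exists_form_of_isOrientedBasis hbasis
  have hνN : IsCoprime ν (N : 𝓞 K) := ⟨1, -w, by rw [hν]; ring⟩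
  have hgcd : Int.gcd N Q.a = 1 :=
    Int.isCoprime_iff_gcd_eq_one.mp (G.isCoprime_a_of_eq_omega_mul ha hd hνN hξ).symm
  refine ⟨FormClass.mk ⟨Q, G.isPrimitive ha hd,
    BinForm.isPosDef_of_a_pos_of_disc_neg ha (hd ▸ G.discr_neg), hd, hgcd⟩, ?_⟩
  have hν0 := hbasis.ne_zero
  refine ((mk_eq_mk_iff _ _).mpr ⟨Units.mk0 ((m : K) / ν) (div_ne_zero hmK hν0), ?_, ?_⟩).symm
  · obtain ⟨r, hr⟩ := (Int.natCast_modEq_iff.mpr hm).symm.dvd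
    have hr' : (m : 𝓞 K) - 1 = N * r := by exact_mod_cast congrArg (Int.cast (R := 𝓞 K)) hr
    refine mem_congrOne_of_eq_mul (α := m) (β := ν) (by simpa using hν0)
      ((Ideal.isCoprime_span_singleton_iff _ _).mpr hνN)
      (Ideal.mem_span_singleton.mpr ⟨r - w, by rw [hν]; linear_combination hr'⟩) ?_
    rw [Units.val_mk0, mul_div_cancel₀ _ hν0]
    exact map_natCast (algebraMap (𝓞 K) K) m
  · have hbasis' := hbasis.smul (inv_ne_zero hν0)
    rw [hξ, mul_comm (G.omega Q), inv_mul_cancel_left₀ hν0, inv_mul_cancel₀ hν0, ← mul_assoc,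
      FractionalIdeal.spanSingleton_mul_spanSingleton, inv_mul_eq_div] at hbasis'
    exact (G.isOrientedBasis_latticeIdeal ha hd).eq_of_mem hbasis'

end OrientedGenerator

namespace BinForm

theorem mul_normSq_automorphy {Q : BinForm} (ha : 0 < Q.a) (hd : Q.disc < 0) (u v : ℤ) :
    (Q.a : ℝ) * Complex.normSq (u * Q.omega + v) = Q.eval v (-u) := by
  obtain ⟨him, hroot⟩ := (Q.omega_spec ha hd _).mpr rfl
  have hre_root := congrArg Complex.re hroot
  have him_root := congrArg Complex.im hroot
  simp only [sq, Complex.add_re, Complex.add_im, Complex.mul_re, Complex.mul_im, Complex.intCast_re,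
    Complex.intCast_im, Complex.zero_re, Complex.zero_im] at hre_root him_root
  have hre : 2 * Q.a * Q.omega.re + Q.b = 0 :=
    mul_left_cancel₀ him.ne' (by linear_combination him_root)
  simp only [Complex.normSq_apply, Complex.add_re, Complex.add_im, Complex.mul_re, Complex.mul_im,
    Complex.intCast_re, Complex.intCast_im, eval]
  push_cast
  linear_combination (u * v + u ^ 2 * Q.omega.re : ℝ) * hre - (u ^ 2 : ℝ) * hre_root

theorem a_mul_eval_eq_of_automorphy_eq {Q Q' : BinForm} (ha : 0 < Q.a) (hd : Q.disc < 0)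
    (ha' : 0 < Q'.a) (hd' : Q'.disc < 0) {s t u v : ℤ}
    (h : (s : ℂ) * Q.omega + t = u * Q'.omega + v) :
    Q'.a * Q.eval t (-s) = Q.a * Q'.eval v (-u) := by
  have hQ := mul_normSq_automorphy ha hd s t
  have hQ' := mul_normSq_automorphy ha' hd' u v
  rw [h] at hQ
  have : (Q'.a : ℝ) * Q.eval t (-s) = Q.a * Q'.eval v (-u) := by
    rw [← hQ, ← hQ', mul_left_comm]
  exact_mod_cast this

theorem eval_dirichletComp {Q₁ Q₂ : BinForm} {B u v : ℤ} {ρ : SL(2, ℤ)} (hQ₁ : Q₁.IsPosDef)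
    (hQ₂ : Q₂.IsPosDef) (hd₁ : Q₁.disc < 0) (hd₂ : Q₂.disc < 0)
    (hB : Q₁.IsCompositionCoeff (Q₂.act ρ) B)
    (h : (ρ 1 0 : ℂ) * (Q₂.act ρ).omega + ρ 1 1 =
      u * (Q₁.dirichletComp (Q₂.act ρ) B).omega + v) :
    (Q₁.dirichletComp (Q₂.act ρ) B).eval v (-u) = Q₁.a * Q₂.a := by
  have ha₃ := (hQ₂.act ρ).a_pos
  have heval := a_mul_eval_eq_of_automorphy_eq ha₃ ((Q₂.disc_act ρ).trans_lt hd₂)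
    (mul_pos hQ₁.a_pos ha₃ : 0 < (Q₁.dirichletComp (Q₂.act ρ) B).a)
    (hB.disc_dirichletComp.trans_lt hd₁) h
  rw [← act_inv_a, ← act_mul, mul_inv_cancel, act_one] at heval
  refine mul_left_cancel₀ ha₃.ne' (heval.symm.trans ?_)
  rw [dirichletComp]
  ring

theorem isCoprime_gcd_of_isCoprime_eval {Q : BinForm} {u v m : ℤ}
    (h : IsCoprime (Q.eval v (-u)) m) : IsCoprime (Int.gcd u v : ℤ) m := by
  refine h.of_isCoprime_of_dvd_left ?_
  have hu := Int.gcd_dvd_left u v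
  have hv := Int.gcd_dvd_right u v
  rw [eval, sq, sq, ← mul_assoc, ← mul_assoc]
  exact dvd_add (dvd_add (hv.mul_left _) ((dvd_neg.mpr hu).mul_left _))
    ((dvd_neg.mpr hu).mul_left _)

theorem Composable.exists_bezout_of_isCompositionCoeff {Q₁ Q₂ : BinForm} {B : ℤ}
    (h : Q₁.Composable Q₂) (hd : Q₁.disc = Q₂.disc) (hB : Q₁.IsCompositionCoeff Q₂ B) :
    ∃ x y z : ℤ, x * Q₁.a + y * Q₂.a + z * B = 1 := by
  obtain ⟨x, y, z, hxyz⟩ := h.exists_bezout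
  obtain ⟨s, hs⟩ := two_dvd_b_add_b hd
  rw [hs, Int.mul_ediv_cancel_left _ two_ne_zero] at hxyz
  obtain ⟨k, hk⟩ := hB.1.symm.dvd
  obtain ⟨l, hl⟩ := hB.2.1.symm.dvd
  have hBs : B = s + Q₁.a * k + Q₂.a * l := by linarith
  exact ⟨x - z * k, y - z * l, z, by rw [hBs]; linear_combination hxyz⟩

end BinForm

theorem mem_lattice {ω z : ℂ} : z ∈ lattice ω ↔ ∃ s t : ℤ, z = s * ω + t := by
  simp only [lattice, Submodule.mem_span_pair, zsmul_eq_mul, mul_one, eq_comm]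

theorem exists_eq_mul_add_of_lattice_mul_eq {ω₁ ω₂ ω₀ : ℂ}
    (h : lattice ω₁ * lattice ω₂ = lattice ω₀) (s t : ℤ) :
    ∃ u v : ℤ, (s : ℂ) * ω₂ + t = u * ω₀ + v := by
  rw [← mem_lattice, ← h]
  simpa using Submodule.mul_mem_mul (mem_lattice.mpr ⟨0, 1, by simp⟩ : (1 : ℂ) ∈ lattice ω₁)
    (mem_lattice.mpr ⟨s, t, rfl⟩)

theorem IsOrientedBasis.exists_eq_mul_one_add_mul {K : Type*} [Field K] [NumberField K]
    {ι : K →+* ℂ} {J : FractionalIdeal (𝓞 K)⁰ K} {ω j : K}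
    (h : IsOrientedBasis ι (FractionalIdeal.spanSingleton (𝓞 K)⁰ j * J) ω 1) {N : ℕ}
    {u v u' v' : ℤ} (hj : j = u * ω + v) (hu : u' ≡ u [ZMOD N]) (hv : v' ≡ v [ZMOD N]) :
    ∃ y ∈ J, (u' : K) * ω + v' = j * (1 + N * y) := by
  obtain ⟨s, hs⟩ := hu.symm.dvd
  obtain ⟨t, ht⟩ := hv.symm.dvd
  have hs' : (u' : K) - u = N * s := by exact_mod_cast congrArg (Int.cast (R := K)) hs
  have ht' : (v' : K) - v = N * t := by exact_mod_cast congrArg (Int.cast (R := K)) ht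
  obtain ⟨y, hy, hy'⟩ := FractionalIdeal.mem_singleton_mul.mp ((h.mem_iff _).mpr ⟨s, t, rfl⟩)
  exact ⟨y, hy, by linear_combination ω * hs' + ht' - hj + (N : K) * hy'⟩

namespace OrientedGenerator

variable {K : Type*} [Field K] [NumberField K] {ι : K →+* ℂ} (G : OrientedGenerator K ι) {N : ℕ}

section Composition

variable {Q₁ Q₂ : BinForm} {B : ℤ}

theorem latticeIdeal_mul_le_iff {J : FractionalIdeal (𝓞 K)⁰ K} :
    G.latticeIdeal Q₁ * G.latticeIdeal Q₂ ≤ J ↔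
      (G.omega Q₁ * G.omega Q₂ ∈ J ∧ G.omega Q₂ ∈ J) ∧ G.omega Q₁ ∈ J ∧ (1 : K) ∈ J := by
  rw [latticeIdeal, latticeIdeal, mul_add, add_mul, mul_one, one_mul]
  simp only [← FractionalIdeal.sup_eq_add, sup_le_iff, FractionalIdeal.one_le,
    FractionalIdeal.spanSingleton_mul_spanSingleton, FractionalIdeal.spanSingleton_le_iff_mem]

theorem exists_omega_eq_mul_omega_add {Q Q₀ : BinForm} {m : ℤ} (ha : 0 < Q.a) (ha₀ : 0 < Q₀.a)
    (hm : Q₀.a = Q.a * m) (hb : Q₀.b ≡ Q.b [ZMOD 2 * Q.a]) :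
    ∃ k : ℤ, G.omega Q = m * G.omega Q₀ + k := by
  obtain ⟨k, hk⟩ := hb.symm.dvd
  have hk' : (Q₀.b : K) - Q.b = 2 * Q.a * k := by exact_mod_cast congrArg (Int.cast (R := K)) hk
  have hm' : (Q₀.a : K) = Q.a * m := by exact_mod_cast congrArg (Int.cast (R := K)) hm
  have ha' : (2 * Q.a : K) ≠ 0 := mul_ne_zero two_ne_zero (by exact_mod_cast ha.ne')
  have hω₀ := G.two_mul_omega ha₀
  rw [hm'] at hω₀
  exact ⟨k, mul_left_cancel₀ ha' (by linear_combination G.two_mul_omega ha - hω₀ + hk')⟩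

theorem exists_omega_eq_omega_dirichletComp (ha₁ : 0 < Q₁.a) (ha₂ : 0 < Q₂.a)
    (hB : Q₁.IsCompositionCoeff Q₂ B) :
    (∃ k : ℤ, G.omega Q₁ = Q₂.a * G.omega (Q₁.dirichletComp Q₂ B) + k) ∧
      ∃ l : ℤ, G.omega Q₂ = Q₁.a * G.omega (Q₁.dirichletComp Q₂ B) + l :=
  ⟨G.exists_omega_eq_mul_omega_add ha₁ (mul_pos ha₁ ha₂) rfl hB.1,
    G.exists_omega_eq_mul_omega_add ha₂ (mul_pos ha₁ ha₂) (mul_comm ..) hB.2.1⟩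

theorem omega_dirichletComp_root (ha₁ : 0 < Q₁.a) (ha₂ : 0 < Q₂.a) (hd : Q₁.disc = discr K)
    (hB : Q₁.IsCompositionCoeff Q₂ B) :
    (Q₁.a * Q₂.a : K) * G.omega (Q₁.dirichletComp Q₂ B) ^ 2 +
      B * G.omega (Q₁.dirichletComp Q₂ B) + (Q₁.dirichletComp Q₂ B).c = 0 := by
  rw [← G.omega_root (mul_pos ha₁ ha₂ : 0 < (Q₁.dirichletComp Q₂ B).a)
    (hB.disc_dirichletComp.trans hd), ← Int.cast_mul]
  rfl

theorem latticeIdeal_mul_le (ha₁ : 0 < Q₁.a) (ha₂ : 0 < Q₂.a) (hd : Q₁.disc = discr K)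
    (hB : Q₁.IsCompositionCoeff Q₂ B) :
    G.latticeIdeal Q₁ * G.latticeIdeal Q₂ ≤ G.latticeIdeal (Q₁.dirichletComp Q₂ B) := by
  obtain ⟨⟨k, hk⟩, ⟨l, hl⟩⟩ := G.exists_omega_eq_omega_dirichletComp ha₁ ha₂ hB
  have hroot := G.omega_dirichletComp_root ha₁ ha₂ hd hB
  rw [latticeIdeal_mul_le_iff]
  simp only [(G.isOrientedBasis_latticeIdeal (mul_pos ha₁ ha₂ : 0 < (Q₁.dirichletComp Q₂ B).a)
    (hB.disc_dirichletComp.trans hd)).mem_iff, mul_one]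
  refine ⟨⟨⟨Q₂.a * l + Q₁.a * k - B, k * l - (Q₁.dirichletComp Q₂ B).c, ?_⟩, ⟨Q₁.a, l, hl⟩⟩,
    ⟨Q₂.a, k, hk⟩, ⟨0, 1, by simp⟩⟩
  rw [hk, hl]
  push_cast
  linear_combination hroot

theorem le_latticeIdeal_mul (ha₁ : 0 < Q₁.a) (ha₂ : 0 < Q₂.a) (hd₁ : Q₁.disc = discr K)
    (hd₂ : Q₂.disc = discr K) (h : Q₁.Composable Q₂) (hB : Q₁.IsCompositionCoeff Q₂ B) :
    G.latticeIdeal (Q₁.dirichletComp Q₂ B) ≤ G.latticeIdeal Q₁ * G.latticeIdeal Q₂ := by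
  obtain ⟨x, y, z, hxyz⟩ := h.exists_bezout_of_isCompositionCoeff (hd₁.trans hd₂.symm) hB
  have hxyz' : (x : K) * Q₁.a + y * Q₂.a + z * B = 1 := by
    exact_mod_cast congrArg (Int.cast (R := K)) hxyz
  obtain ⟨⟨k, hk⟩, ⟨l, hl⟩⟩ := G.exists_omega_eq_omega_dirichletComp ha₁ ha₂ hB
  have hroot := G.omega_dirichletComp_root ha₁ ha₂ hd₁ hB
  obtain ⟨⟨hω₁₂, hω₂⟩, hω₁, hone⟩ := G.latticeIdeal_mul_le_iff.mp
    (le_refl (G.latticeIdeal Q₁ * G.latticeIdeal Q₂))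
  set M := G.latticeIdeal Q₁ * G.latticeIdeal Q₂
  -- `ω₀ = (x a₁ + y a₂ + z B) ω₀`, where `a₁ ω₀ = ω₂ - l`, `a₂ ω₀ = ω₁ - k` and, by the quadratic
  -- equation of `ω₀`, also `B ω₀ = -a₁ a₂ ω₀² - c₀ = -(ω₁ - k) (ω₂ - l) - c₀`
  have hω₀ : G.omega (Q₁.dirichletComp Q₂ B) =
      ((-z : ℤ) : K) * (G.omega Q₁ * G.omega Q₂) + ((y + z * l : ℤ) : K) * G.omega Q₁ +
      ((x + z * k : ℤ) : K) * G.omega Q₂ +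
      ((-(x * l) - y * k - z * (k * l + (Q₁.dirichletComp Q₂ B).c) : ℤ) : K) * 1 := by
    rw [hk, hl]
    push_cast
    linear_combination (-G.omega (Q₁.dirichletComp Q₂ B)) * hxyz' + (z : K) * hroot
  rw [latticeIdeal, ← FractionalIdeal.sup_eq_add, sup_le_iff,
    FractionalIdeal.spanSingleton_le_iff_mem, FractionalIdeal.one_le, hω₀]
  have hadd {a b : K} : a ∈ M → b ∈ M → a + b ∈ M := (M : Submodule (𝓞 K) K).add_mem
  have hmul (n : ℤ) {a : K} (ha : a ∈ M) : (n : K) * a ∈ M := by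
    rw [← zsmul_eq_mul]
    exact (M : Submodule (𝓞 K) K).toAddSubgroup.zsmul_mem ha n
  exact ⟨hadd (hadd (hadd (hmul _ hω₁₂) (hmul _ hω₁)) (hmul _ hω₂)) (hmul _ hone), hone⟩

theorem latticeIdeal_mul (ha₁ : 0 < Q₁.a) (ha₂ : 0 < Q₂.a) (hd₁ : Q₁.disc = discr K)
    (hd₂ : Q₂.disc = discr K) (h : Q₁.Composable Q₂) (hB : Q₁.IsCompositionCoeff Q₂ B) :
    G.latticeIdeal Q₁ * G.latticeIdeal Q₂ = G.latticeIdeal (Q₁.dirichletComp Q₂ B) :=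
  (G.latticeIdeal_mul_le ha₁ ha₂ hd₁ hB).antisymm (G.le_latticeIdeal_mul ha₁ ha₂ hd₁ hd₂ h hB)

theorem lattice_eq_map_latticeIdeal {Q : BinForm} (ha : 0 < Q.a) (hd : Q.disc = discr K) :
    lattice Q.omega = ((G.latticeIdeal Q : Submodule (𝓞 K) K).restrictScalars ℤ).map
      ι.toIntAlgHom.toLinearMap :=
  SetLike.coe_injective (G.image_latticeIdeal ha hd).symm

theorem lattice_mul (G : OrientedGenerator K ι) (ha₁ : 0 < Q₁.a) (ha₂ : 0 < Q₂.a)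
    (hd₁ : Q₁.disc = discr K) (hd₂ : Q₂.disc = discr K) (h : Q₁.Composable Q₂)
    (hB : Q₁.IsCompositionCoeff Q₂ B) :
    lattice Q₁.omega * lattice Q₂.omega = lattice (Q₁.dirichletComp Q₂ B).omega := by
  rw [G.lattice_eq_map_latticeIdeal ha₁ hd₁, G.lattice_eq_map_latticeIdeal ha₂ hd₂,
    G.lattice_eq_map_latticeIdeal (mul_pos ha₁ ha₂ : 0 < (Q₁.dirichletComp Q₂ B).a)
      (hB.disc_dirichletComp.trans hd₁), ← Submodule.map_mul, ← Submodule.restrictScalars_mul,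
    ← FractionalIdeal.coe_mul, G.latticeIdeal_mul ha₁ ha₂ hd₁ hd₂ h hB]

end Composition

theorem exists_act_eq_of_modEq (G : OrientedGenerator K ι) {Q : BinForm} (hQ : Q.IsPosDef)
    (hd : Q.disc = discr K) {u v : ℤ} (hcop : IsCoprime (Q.eval v (-u)) (N : ℤ)) {σ : SL(2, ℤ)}
    (hu : σ 1 0 ≡ u [ZMOD N]) (hv : σ 1 1 ≡ v [ZMOD N]) :
    ∃ Q' : FormsPrimeTo N (discr K), Q'.1.act σ = Q := by
  have ha := (hQ.act σ⁻¹).a_pos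
  have hd' := (Q.disc_act σ⁻¹).trans hd
  have hgcd : Int.gcd N (Q.act σ⁻¹).a = 1 := by
    have hmod : Q.eval (σ 1 1) (-σ 1 0) ≡ Q.eval v (-u) [ZMOD N] := by
      unfold BinForm.eval
      gcongr
    obtain ⟨c, hc⟩ := hmod.symm.dvd
    rw [← Int.isCoprime_iff_gcd_eq_one, BinForm.act_inv_a, eq_add_of_sub_eq' hc]
    exact (hcop.add_mul_left_left c).symm
  exact ⟨⟨Q.act σ⁻¹, G.isPrimitive ha hd', hQ.act σ⁻¹, hd', hgcd⟩, by
    rw [← BinForm.act_mul, inv_mul_cancel, BinForm.act_one]⟩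

theorem mk_idealOfForm_mul (Q₁ Q₂ Q₄ : FormsPrimeTo N (discr K)) (hN : N ≠ 0) {Q₀ : BinForm}
    {ρ σ : SL(2, ℤ)} (hσ : Q₄.1.act σ = Q₀)
    (hmul : G.latticeIdeal Q₁.1 * G.latticeIdeal (Q₂.1.act ρ) = G.latticeIdeal Q₀) {u v : ℤ}
    (huv : (ρ 1 0 : K) * G.omega (Q₂.1.act ρ) + ρ 1 1 = u * G.omega Q₀ + v)
    (hu : σ 1 0 ≡ u [ZMOD N]) (hv : σ 1 1 ≡ v [ZMOD N]) :
    (QuotientGroup.mk (G.idealOfForm Q₁ * G.idealOfForm Q₂) :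
      RayClassGroup K (Ideal.span {(N : 𝓞 K)})) = QuotientGroup.mk (G.idealOfForm Q₄) := by
  obtain ⟨-, pos₂, disc₂, -⟩ := Q₂.2
  obtain ⟨-, pos₄, disc₄, -⟩ := Q₄.2
  have hjρ := left_ne_zero_of_mul_eq_one (G.automorphy_mul pos₂ disc₂ ρ).2
  have hjσ := left_ne_zero_of_mul_eq_one (G.automorphy_mul pos₄ disc₄ σ).2
  have hLσ := G.latticeIdeal_act pos₄ disc₄ σ
  have hbasis := G.isOrientedBasis_latticeIdeal (pos₄.act σ).a_pos ((Q₄.1.disc_act σ).trans disc₄)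
  rw [hσ] at hjσ hLσ hbasis
  set jρ := (ρ 1 0 : K) * G.omega (Q₂.1.act ρ) + ρ 1 1
  set jσ := (σ 1 0 : K) * G.omega Q₀ + σ 1 1
  have hLρ : G.latticeIdeal Q₀ = FractionalIdeal.spanSingleton (𝓞 K)⁰ jρ *
      (G.latticeIdeal Q₁.1 * G.latticeIdeal Q₂.1) := by
    rw [← hmul, G.latticeIdeal_act pos₂ disc₂ ρ, mul_left_comm]
  obtain ⟨y, hy, hjy : jσ = jρ * (1 + N * y)⟩ :=
    (hLρ ▸ hbasis).exists_eq_mul_one_add_mul huv hu hv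
  refine ((mk_eq_mk_iff _ _).mpr ⟨Units.mk0 (jσ / jρ) (div_ne_zero hjσ hjρ), ?_, ?_⟩).symm
  · exact mem_congrOne_of_eq_one_add_mul hN
      (mul_mem (G.idealOfForm Q₁).2 (G.idealOfForm Q₂).2) hy
      (by rw [Units.val_mk0, hjy, mul_div_cancel_left₀ _ hjρ])
  · calc G.latticeIdeal Q₁.1 * G.latticeIdeal Q₂.1
      _ = FractionalIdeal.spanSingleton (𝓞 K)⁰ jρ⁻¹ * G.latticeIdeal Q₀ := by
        rw [hLρ, ← mul_assoc, FractionalIdeal.spanSingleton_mul_spanSingleton, inv_mul_cancel₀ hjρ,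
          FractionalIdeal.spanSingleton_one, one_mul]
      _ = FractionalIdeal.spanSingleton (𝓞 K)⁰ (jσ / jρ) * G.latticeIdeal Q₄.1 := by
        rw [hLσ, ← mul_assoc, FractionalIdeal.spanSingleton_mul_spanSingleton, inv_mul_eq_div]

theorem isCoprime_eval_dirichletComp (G : OrientedGenerator K ι)
    (Q₁ Q₂ : FormsPrimeTo N (discr K)) {ρ : SL(2, ℤ)} {B u v : ℤ}
    (hB : Q₁.1.IsCompositionCoeff (Q₂.1.act ρ) B)
    (huv : (ρ 1 0 : ℂ) * (Q₂.1.act ρ).omega + ρ 1 1 =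
      u * (Q₁.1.dirichletComp (Q₂.1.act ρ) B).omega + v) :
    IsCoprime ((Q₁.1.dirichletComp (Q₂.1.act ρ) B).eval v (-u)) (N : ℤ) := by
  obtain ⟨-, pos₁, disc₁, gcd₁⟩ := Q₁.2
  obtain ⟨-, pos₂, disc₂, gcd₂⟩ := Q₂.2
  rw [BinForm.eval_dirichletComp pos₁ pos₂ (disc₁.trans_lt G.discr_neg)
    (disc₂.trans_lt G.discr_neg) hB huv]
  exact (Int.isCoprime_iff_gcd_eq_one.mpr gcd₁).symm.mul_left
    (Int.isCoprime_iff_gcd_eq_one.mpr gcd₂).symm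

theorem exists_act_eq_dirichletComp (Q₁ Q₂ : FormsPrimeTo N (discr K)) (hN : N ≠ 0)
    {ρ σ : SL(2, ℤ)} (hρ : Q₁.1.Composable (Q₂.1.act ρ)) {B u v : ℤ}
    (hB : Q₁.1.IsCompositionCoeff (Q₂.1.act ρ) B)
    (huv : (ρ 1 0 : ℂ) * (Q₂.1.act ρ).omega + ρ 1 1 =
      u * (Q₁.1.dirichletComp (Q₂.1.act ρ) B).omega + v)
    (hu : σ 1 0 ≡ u [ZMOD N]) (hv : σ 1 1 ≡ v [ZMOD N]) :
    ∃ Q₄ : FormsPrimeTo N (discr K), Q₄.1.act σ = Q₁.1.dirichletComp (Q₂.1.act ρ) B ∧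
      (QuotientGroup.mk (G.idealOfForm Q₁ * G.idealOfForm Q₂) :
        RayClassGroup K (Ideal.span {(N : 𝓞 K)})) = QuotientGroup.mk (G.idealOfForm Q₄) := by
  obtain ⟨-, pos₁, disc₁, -⟩ := Q₁.2
  obtain ⟨-, pos₂, disc₂, -⟩ := Q₂.2
  have ha₃ := (pos₂.act ρ).a_pos
  have disc₃ := (Q₂.1.disc_act ρ).trans disc₂
  have disc₀ := hB.disc_dirichletComp.trans disc₁
  have pos₀ := BinForm.isPosDef_of_a_pos_of_disc_neg (mul_pos pos₁.a_pos ha₃)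
    (disc₀.trans_lt G.discr_neg)
  obtain ⟨Q₄, hQ₄⟩ := G.exists_act_eq_of_modEq pos₀ disc₀
    (G.isCoprime_eval_dirichletComp Q₁ Q₂ hB huv) hu hv
  have huvK : (ρ 1 0 : K) * G.omega (Q₂.1.act ρ) + ρ 1 1 =
      u * G.omega (Q₁.1.dirichletComp (Q₂.1.act ρ) B) + v :=
    ι.injective (by simpa [G.map_omega ha₃ disc₃, G.map_omega pos₀.a_pos disc₀] using huv)
  exact ⟨Q₄, hQ₄, G.mk_idealOfForm_mul Q₁ Q₂ Q₄ hN hQ₄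
    (G.latticeIdeal_mul pos₁.a_pos ha₃ disc₁ disc₃ hρ hB) huvK hu hv⟩

end OrientedGenerator

theorem theorem2p8_general (K : Type*) [Field K] [NumberField K] [Algebra.IsQuadraticExtension ℚ K]
    [NumberField.IsTotallyComplex K] (ι : K →+* ℂ) (N : ℕ) (hN : 0 < N) :
    ∃ (_ : CommGroup (FormClass N (discr K)))
      (φ : FormClass N (discr K) ≃* RayClassGroup K (Ideal.span {(N : 𝓞 K)})),
      (∀ Q : FormsPrimeTo N (discr K),
        ∃ 𝔞 : idealsPrimeTo K (Ideal.span {(N : 𝓞 K)}),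
          ι '' {x : K | x ∈ ((𝔞 : (FractionalIdeal (𝓞 K)⁰ K)ˣ) : FractionalIdeal (𝓞 K)⁰ K)} =
            (lattice Q.1.omega : Set ℂ) ∧
          φ (FormClass.mk Q) = QuotientGroup.mk 𝔞) ∧
      (∀ Q₁ Q₂ : FormsPrimeTo N (discr K),
        (∃ ρ : SL(2, ℤ), Q₁.1.Composable (Q₂.1.act ρ)) ∧
        ∀ ρ : SL(2, ℤ), Q₁.1.Composable (Q₂.1.act ρ) →
          (∃ B : ℤ, Q₁.1.IsCompositionCoeff (Q₂.1.act ρ) B) ∧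
          ∀ B : ℤ, Q₁.1.IsCompositionCoeff (Q₂.1.act ρ) B →
            lattice Q₁.1.omega * lattice (Q₂.1.act ρ).omega =
              lattice (Q₁.1.dirichletComp (Q₂.1.act ρ) B).omega ∧
            (∃ u v : ℤ, (ρ 1 0 : ℂ) * (Q₂.1.act ρ).omega + (ρ 1 1 : ℂ) =
              (u : ℂ) * (Q₁.1.dirichletComp (Q₂.1.act ρ) B).omega + (v : ℂ)) ∧
            ∀ u v : ℤ, (ρ 1 0 : ℂ) * (Q₂.1.act ρ).omega + (ρ 1 1 : ℂ) =
                (u : ℂ) * (Q₁.1.dirichletComp (Q₂.1.act ρ) B).omega + (v : ℂ) →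
              (∃ σ : SL(2, ℤ), σ 1 0 ≡ u [ZMOD N] ∧ σ 1 1 ≡ v [ZMOD N]) ∧
              ∀ σ : SL(2, ℤ), σ 1 0 ≡ u [ZMOD N] → σ 1 1 ≡ v [ZMOD N] →
                ∃ Q₄ : FormsPrimeTo N (discr K),
                  Q₄.1.act σ = Q₁.1.dirichletComp (Q₂.1.act ρ) B ∧
                  FormClass.mk Q₁ * FormClass.mk Q₂ = FormClass.mk Q₄) := by
  obtain ⟨G⟩ := nonempty_orientedGenerator ι
  let e := Equiv.ofBijective (G.classMap N) ⟨G.classMap_injective, G.classMap_surjective hN.ne'⟩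
  let := e.commGroup
  refine ⟨e.commGroup, e.mulEquiv, fun Q => ⟨G.idealOfForm Q, ?_, rfl⟩, fun Q₁ Q₂ => ?_⟩
  · exact G.image_latticeIdeal Q.2.2.1.a_pos Q.2.2.2.1
  obtain ⟨-, pos₁, disc₁, -⟩ := Q₁.2
  obtain ⟨prim₂, pos₂, disc₂, -⟩ := Q₂.2
  refine ⟨Q₁.1.exists_composable pos₁.a_pos.ne' prim₂, fun ρ hρ => ?_⟩
  have disc₃ := (Q₂.1.disc_act ρ).trans disc₂
  refine ⟨hρ.exists_isCompositionCoeff (disc₁.trans disc₃.symm), fun B hB => ?_⟩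
  have hlat := G.lattice_mul pos₁.a_pos (pos₂.act ρ).a_pos disc₁ disc₃ hρ hB
  refine ⟨hlat, exists_eq_mul_add_of_lattice_mul_eq hlat _ _, fun u v huv => ?_⟩
  refine ⟨?_, fun σ hu hv => ?_⟩
  · exact exists_SL2_row_modEq (by exact_mod_cast hN.ne')
      (BinForm.isCoprime_gcd_of_isCoprime_eval (G.isCoprime_eval_dirichletComp Q₁ Q₂ hB huv))
  · obtain ⟨Q₄, hQ₄, hmul⟩ := G.exists_act_eq_dirichletComp Q₁ Q₂ hN.ne' hρ hB huv hu hv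
    exact ⟨Q₄, hQ₄, e.mulEquiv.injective ((map_mul e.mulEquiv _ _).trans hmul)⟩

theorem theorem2p8 (K : Type*) [Field K] [NumberField K] [Algebra.IsQuadraticExtension ℚ K]
    [NumberField.IsTotallyComplex K] (ι : K →+* ℂ)
    (hK₁ : ∀ x : K, x ^ 2 ≠ -1) (hK₃ : ∀ x : K, x ^ 2 ≠ -3)
    (N : ℕ) (hN : 0 < N) :
    ∃ (_ : CommGroup (FormClass N (discr K)))
      (φ : FormClass N (discr K) ≃* RayClassGroup K (Ideal.span {(N : 𝓞 K)})),
      -- `φ [Q]` is the ray class of the fractional ideal `[ω_Q, 1]`, which is prime to `N𝓞_K`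
      (∀ Q : FormsPrimeTo N (discr K),
        ∃ 𝔞 : idealsPrimeTo K (Ideal.span {(N : 𝓞 K)}),
          ι '' {x : K | x ∈ ((𝔞 : (FractionalIdeal (𝓞 K)⁰ K)ˣ) : FractionalIdeal (𝓞 K)⁰ K)} = (lattice Q.1.omega : Set ℂ) ∧
          φ (FormClass.mk Q) = QuotientGroup.mk 𝔞) ∧
      -- the product of two classes through Dirichlet composition
      (∀ Q₁ Q₂ : FormsPrimeTo N (discr K),
        (∃ ρ : SL(2, ℤ), Q₁.1.Composable (Q₂.1.act ρ)) ∧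
        ∀ ρ : SL(2, ℤ), Q₁.1.Composable (Q₂.1.act ρ) →
          (∃ B : ℤ, Q₁.1.IsCompositionCoeff (Q₂.1.act ρ) B) ∧
          ∀ B : ℤ, Q₁.1.IsCompositionCoeff (Q₂.1.act ρ) B →
            lattice Q₁.1.omega * lattice (Q₂.1.act ρ).omega =
              lattice (Q₁.1.dirichletComp (Q₂.1.act ρ) B).omega ∧
            (∃ u v : ℤ, (ρ 1 0 : ℂ) * (Q₂.1.act ρ).omega + (ρ 1 1 : ℂ) =
              (u : ℂ) * (Q₁.1.dirichletComp (Q₂.1.act ρ) B).omega + (v : ℂ)) ∧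
            ∀ u v : ℤ, (ρ 1 0 : ℂ) * (Q₂.1.act ρ).omega + (ρ 1 1 : ℂ) =
                (u : ℂ) * (Q₁.1.dirichletComp (Q₂.1.act ρ) B).omega + (v : ℂ) →
              (∃ σ : SL(2, ℤ), σ 1 0 ≡ u [ZMOD N] ∧ σ 1 1 ≡ v [ZMOD N]) ∧
              ∀ σ : SL(2, ℤ), σ 1 0 ≡ u [ZMOD N] → σ 1 1 ≡ v [ZMOD N] →
                ∃ Q₄ : FormsPrimeTo N (discr K),
                  Q₄.1.act σ = Q₁.1.dirichletComp (Q₂.1.act ρ) B ∧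
                  FormClass.mk Q₁ * FormClass.mk Q₂ = FormClass.mk Q₄) :=
  theorem2p8_general K ι N hN
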